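/- Let $(\mathcal S,\mathcal A,p,r,p_0)$ be a Markov decision process with finite $\mathcal S,\mathcal A$, let $\pi$ be a policy, and let $(S_t,A_t)_{t\ge0}$ be generated by $S_0\sim p_0$, $A_t\sim\pi(\cdot\mid S_t)$, $S_{t+1}\sim p(\cdot\mid S_t,A_t)$, with rewards $R_{t+1}=r(S_t,A_t)$. Assume that the state transition matrix $P=P_\pi$, $P(s,s')=\sum_a\pi(a|s)p(s'|s,a)$, is irreducible and aperiodic; let $d_\pi$ be its stationary distribution, $D=\operatorname{diag}(d_\pi)$, $r_\pi(s)=\sum_a\pi(a|s)r(s,a)$. Let $\lambda\in[0,1)$ and let $x:\mathcal S\to\mathbb R^d$ be arbitrary features, $X$ the matrix with rows $x(s)^\top$. Put $$J_\pi=\lim_{T\to\infty}\tfrac1T\,\mathbb E\Big[\sum_{t=0}^{T-1}R_{t+1}\Big],\quad P_\lambda=(1-\lambda)\sum_{m\ge0}\lambda^mP^{m+1},\quad r_\lambda=\sum_{k\ge0}\lambda^kP^kr_\pi,$$ $$\overline A=X^\top D(P_\lambda-I)X,\qquad \overline b=X^\top D\big(r_\lambda-\tfrac{J_\pi}{1-\lambda}\mathbf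 1\big),\qquad \overline W_*=\{w\in\mathbb R^d:\overline Aw+\overline b=\mathbf 0\}.$$ For $\alpha_t=\alpha/(t+t_0)^\xi$ and $\beta_t=c_\beta\alpha_t$, with constants $\alpha,t_0,c_\beta>0$, and deterministic $w_0\in\mathbb R^d$, $\hat J_0\in\mathbb R$, average-reward linear TD($\lambda$) is $$e_t=\lambda e_{t-1}+x(S_t),\ e_{-1}=\mathbf 0,\qquad w_{t+1}=w_t+\alpha_t\big(R_{t+1}-\hat J_t+x(S_{t+1})^\top w_t-x(S_t)^\top w_t\big)e_t,\qquad \hat J_{t+1}=\hat J_t+\beta_t(R_{t+1}-\hat J_t).$$ Let $K=\{w\in\mathbb R^d: Xw=c\mathbf 1\text{ for some }c\in\mathbb R\}$, let $\Pi$ be the orthogonal projection onto $K^\perp$, let $q=\sum_{k\ge0}\lambda^kX^\top d_\pi$ (the stationary mean of $e_t$), and let $$\widetilde A=\begin{bmatrix}-c_\beta&\mathbf 0^\top\\-\Pi q&\Pi\overline A\end{bmatrix}.$$ Then the limit $J_\pi$ exists, $\overline W_*$ is nonempty, and for all sufficiently large $c_\beta$ the following holds. There is a constant $c>0$ with $$z^\top\widetilde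 Az\le-c\|z\|^2\qquad\text{for all }z\in\mathbb R\times K^\perp,\tag{1}$$ and for every $c>0$ satisfying (1), every $\xi\in(\tfrac12,1]$, and all sufficiently large $\alpha$ and $t_0$, the number $\kappa=\alpha c$ satisfies $\kappa>1$ and there is a constant $C>0$, not depending on $w_0$, $\hat J_0$ or $t$, such that for all $w_0$, $\hat J_0$ and all $t\ge1$ (the expectation being finite) $$\mathbb E\big[(\hat J_t-J_\pi)^2+d(w_t,\overline W_*)^2\big]\le C\Big(\frac{t_0}{t}\Big)^{\lfloor\kappa\rfloor}\big[(\hat J_0-J_\pi)^2+d(w_0,\overline W_*)^2\big]+C\,\frac{\ln(t+t_0)}{(t+t_0)^{\min(2\xi-1,\lfloor\kappa\rfloor-1)}},$$ where $d(\cdot,\overline W_*)$ is the Euclidean distance. -/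

import Mathlib

open Filter Topology MeasureTheory
open scoped Matrix

noncomputable section

namespace AvgTD

/-- A finite Markov decision process `(𝒮, 𝒜, p, r, p₀)`; `p s a s'` is the probability of moving
from `s` to `s'` under the action `a`. -/
structure MDP (𝒮 𝒜 : Type*) [Fintype 𝒮] where
  p : 𝒮 → 𝒜 → 𝒮 → ℝ
  p_nonneg : ∀ s a s', 0 ≤ p s a s'
  p_sum : ∀ s a, ∑ s', p s a s' = 1
  r : 𝒮 → 𝒜 → ℝ
  p₀ : 𝒮 → ℝ
  p₀_nonneg : ∀ s, 0 ≤ p₀ s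
  p₀_sum : ∑ s, p₀ s = 1

/-- A (stationary, randomized) policy; `prob s a` is `π(a | s)`. -/
structure Policy (𝒮 𝒜 : Type*) [Fintype 𝒜] where
  prob : 𝒮 → 𝒜 → ℝ
  prob_nonneg : ∀ s a, 0 ≤ prob s a
  prob_sum : ∀ s, ∑ a, prob s a = 1

section Model

variable {𝒮 𝒜 : Type*} [Fintype 𝒮] [DecidableEq 𝒮] [Fintype 𝒜]

/-- The state transition matrix `P_π`. -/
def transMatrix (M : MDP 𝒮 𝒜) (π : Policy 𝒮 𝒜) : Matrix 𝒮 𝒮 ℝ :=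
  Matrix.of fun s s' => ∑ a, π.prob s a * M.p s a s'

/-- The expected immediate reward `r_π`. -/
def rewardVec (M : MDP 𝒮 𝒜) (π : Policy 𝒮 𝒜) : 𝒮 → ℝ :=
  fun s => ∑ a, π.prob s a * M.r s a

/-- Aperiodicity: for every state the greatest common divisor of the possible return times is 1. -/
def Aperiodic (P : Matrix 𝒮 𝒮 ℝ) : Prop :=
  ∀ s : 𝒮, ∀ k : ℕ, (∀ n : ℕ, 0 < n → 0 < (P ^ n) s s → k ∣ n) → k = 1

/-- `d` is a stationary probability vector of `P`. -/
structure IsStationary (P : Matrix 𝒮 𝒮 ℝ) (d : 𝒮 → ℝ) : Prop where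
  nonneg : ∀ s, 0 ≤ d s
  sum_eq_one : ∑ s, d s = 1
  invariant : d ᵥ* P = d

/-- The stationary distribution of `P` (for an irreducible stochastic `P` there is exactly one). -/
def stationaryDist (P : Matrix 𝒮 𝒮 ℝ) : 𝒮 → ℝ :=
  Classical.epsilon (IsStationary P)

/-- `P_λ = (1 - λ) ∑ₘ λᵐ P^(m+1)`. -/
def transMatrixLam (P : Matrix 𝒮 𝒮 ℝ) (lam : ℝ) : Matrix 𝒮 𝒮 ℝ :=
  Matrix.of fun s s' => (1 - lam) * ∑' m : ℕ, lam ^ m * (P ^ (m + 1)) s s'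

/-- `r_λ = ∑ₖ λᵏ Pᵏ r_π`. -/
def rewardVecLam (P : Matrix 𝒮 𝒮 ℝ) (rπ : 𝒮 → ℝ) (lam : ℝ) : 𝒮 → ℝ :=
  fun s => ∑' k : ℕ, lam ^ k * ((P ^ k) *ᵥ rπ) s

variable {d : ℕ}

/-- The feature matrix `X`, with rows `x(s)ᵀ`. -/
def featureMatrix (x : 𝒮 → EuclideanSpace ℝ (Fin d)) : Matrix 𝒮 (Fin d) ℝ :=
  Matrix.of fun s i => x s i

/-- `A̅ = Xᵀ D_π (P_λ - I) X`. -/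
def Abar (M : MDP 𝒮 𝒜) (π : Policy 𝒮 𝒜) (x : 𝒮 → EuclideanSpace ℝ (Fin d)) (lam : ℝ) :
    Matrix (Fin d) (Fin d) ℝ :=
  (featureMatrix x)ᵀ * Matrix.diagonal (stationaryDist (transMatrix M π)) *
    (transMatrixLam (transMatrix M π) lam - 1) * featureMatrix x

/-- `b̅ = Xᵀ D_π (r_λ - J / (1 - λ) 𝟏)`. -/
def bbar (M : MDP 𝒮 𝒜) (π : Policy 𝒮 𝒜) (x : 𝒮 → EuclideanSpace ℝ (Fin d)) (lam J : ℝ) :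
    Fin d → ℝ :=
  ((featureMatrix x)ᵀ * Matrix.diagonal (stationaryDist (transMatrix M π))) *ᵥ
    fun s => rewardVecLam (transMatrix M π) (rewardVec M π) lam s - J / (1 - lam)

/-- `W̅_* = {w | A̅ w + b̅ = 0}`. -/
def Wstar (M : MDP 𝒮 𝒜) (π : Policy 𝒮 𝒜) (x : 𝒮 → EuclideanSpace ℝ (Fin d)) (lam J : ℝ) :
    Set (EuclideanSpace ℝ (Fin d)) :=
  {w | Abar M π x lam *ᵥ (fun i => w i) + bbar M π x lam J = 0}

/-- The weights whose value function `X w` is a multiple of `𝟏`. This is `ker X₁` for every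
decomposition `X = X₁ + 𝟏 θᵀ` with `𝟏 ∉ col X₁`. -/
def constKer (x : 𝒮 → EuclideanSpace ℝ (Fin d)) : Submodule ℝ (EuclideanSpace ℝ (Fin d)) where
  carrier := {w | ∃ c : ℝ, ∀ s, inner ℝ (x s) w = c}
  add_mem' := by
    rintro v w ⟨a, ha⟩ ⟨b, hb⟩
    exact ⟨a + b, fun s => by rw [inner_add_right, ha, hb]⟩
  zero_mem' := ⟨0, fun s => inner_zero_right _⟩
  smul_mem' := by
    rintro k w ⟨a, ha⟩
    exact ⟨k * a, fun s => by rw [real_inner_smul_right, ha]⟩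

/-- The mean `∑ₖ λᵏ 𝔼[x(S₋ₖ)]` of the eligibility trace `∑ₖ λᵏ x(S₋ₖ)` of the stationary chain. -/
def traceMean (M : MDP 𝒮 𝒜) (π : Policy 𝒮 𝒜) (x : 𝒮 → EuclideanSpace ℝ (Fin d)) (lam : ℝ) :
    EuclideanSpace ℝ (Fin d) :=
  ∑' k : ℕ, lam ^ k • ∑ s, stationaryDist (transMatrix M π) s • x s

/-- The quadratic form `zᵀ Ã z` at `z = (y, v)` of the augmented mean matrix
`Ã = [[-c_β, 0], [-Π q, Π A̅]]`, with `q` the stationary mean of the trace and `Π` the orthogonal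
projection onto `(ker X₁)ᗮ`. -/
def augForm (M : MDP 𝒮 𝒜) (π : Policy 𝒮 𝒜) (x : 𝒮 → EuclideanSpace ℝ (Fin d)) (lam cβ : ℝ)
    (y : ℝ) (v : EuclideanSpace ℝ (Fin d)) : ℝ :=
  y * (-cβ * y) +
    inner ℝ v ((constKer x)ᗮ.starProjection
      (Matrix.toEuclideanLin (Abar M π x lam) v - y • traceMean M π x lam))

/-- `zᵀ Ã z ≤ -c ‖z‖²` for all `z ∈ ℝ × (ker X₁)ᗮ`. -/
def AugNegDef (M : MDP 𝒮 𝒜) (π : Policy 𝒮 𝒜) (x : 𝒮 → EuclideanSpace ℝ (Fin d))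
    (lam cβ c : ℝ) : Prop :=
  ∀ y : ℝ, ∀ v ∈ (constKer x)ᗮ, augForm M π x lam cβ y v ≤ -c * (y ^ 2 + ‖v‖ ^ 2)

end Model

section Dynamics

variable {𝒮 𝒜 : Type*} [Fintype 𝒮] [Fintype 𝒜] {Ω : Type*} [MeasurableSpace Ω]

/-- `(S_t, A_t)` is the state-action process of the MDP under `π`:
`S₀ ∼ p₀`, `A_t ∼ π(· | S_t)`, `S_{t+1} ∼ p(· | S_t, A_t)` (given the past). -/
structure IsTrajectory (M : MDP 𝒮 𝒜) (π : Policy 𝒮 𝒜) (ℙ : Measure Ω)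
    (S : ℕ → Ω → 𝒮) (A : ℕ → Ω → 𝒜) : Prop where
  measurable_state : ∀ t s, MeasurableSet {ω | S t ω = s}
  measurable_action : ∀ t a, MeasurableSet {ω | A t ω = a}
  law : ∀ (n : ℕ) (s : ℕ → 𝒮) (a : ℕ → 𝒜),
    ℙ.real {ω | ∀ i ≤ n, S i ω = s i ∧ A i ω = a i} =
      M.p₀ (s 0) * (∏ i ∈ Finset.range (n + 1), π.prob (s i) (a i)) *
        ∏ i ∈ Finset.range n, M.p (s i) (a i) (s (i + 1))

/-- `(1 / T) 𝔼[R_1 + ⋯ + R_T]` with `R_{t+1} = r(S_t, A_t)`. -/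
def meanReward (M : MDP 𝒮 𝒜) (ℙ : Measure Ω) (S : ℕ → Ω → 𝒮) (A : ℕ → Ω → 𝒜) (T : ℕ) : ℝ :=
  1 / (T : ℝ) * ∫ ω, ∑ t ∈ Finset.range T, M.r (S t ω) (A t ω) ∂ℙ

/-- The average reward `J_π`, the limit of `meanReward` as `T → ∞`. -/
def avgReward (M : MDP 𝒮 𝒜) (ℙ : Measure Ω) (S : ℕ → Ω → 𝒮) (A : ℕ → Ω → 𝒜) : ℝ :=
  limUnder atTop (meanReward M ℙ S A)

end Dynamics

section Algorithm

variable {𝒮 𝒜 : Type*} {d : ℕ}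

/-- The learning rate `α_t = α / (t + t₀)^ξ`. -/
def stepSize (α t₀ ξ : ℝ) (t : ℕ) : ℝ := α / ((t : ℝ) + t₀) ^ ξ

/-- The eligibility trace along a state path: `e_t = λ e_{t-1} + x(S_t)`, `e_{-1} = 0`. -/
def trace (x : 𝒮 → EuclideanSpace ℝ (Fin d)) (lam : ℝ) (s : ℕ → 𝒮) :
    ℕ → EuclideanSpace ℝ (Fin d)
  | 0 => x (s 0)
  | t + 1 => lam • trace x lam s t + x (s (t + 1))

/-- The average-reward estimate along a path:
`Ĵ_{t+1} = Ĵ_t + β_t (R_{t+1} - Ĵ_t)`. -/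
def Jhat (r : 𝒮 → 𝒜 → ℝ) (β : ℕ → ℝ) (J₀ : ℝ) (s : ℕ → 𝒮) (a : ℕ → 𝒜) : ℕ → ℝ
  | 0 => J₀
  | t + 1 => Jhat r β J₀ s a t + β t * (r (s t) (a t) - Jhat r β J₀ s a t)

/-- The weights along a path:
`w_{t+1} = w_t + α_t (R_{t+1} - Ĵ_t + x(S_{t+1})ᵀ w_t - x(S_t)ᵀ w_t) e_t`. -/
def weight (r : 𝒮 → 𝒜 → ℝ) (x : 𝒮 → EuclideanSpace ℝ (Fin d)) (lam : ℝ) (α β : ℕ → ℝ)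
    (w₀ : EuclideanSpace ℝ (Fin d)) (J₀ : ℝ) (s : ℕ → 𝒮) (a : ℕ → 𝒜) :
    ℕ → EuclideanSpace ℝ (Fin d)
  | 0 => w₀
  | t + 1 =>
    weight r x lam α β w₀ J₀ s a t +
      (α t * (r (s t) (a t) - Jhat r β J₀ s a t
        + inner ℝ (x (s (t + 1))) (weight r x lam α β w₀ J₀ s a t)
        - inner ℝ (x (s t)) (weight r x lam α β w₀ J₀ s a t))) • trace x lam s t

/-- `(Ĵ_t - J_π)² + d(w_t, W̅_*)²` for given values of `Ĵ_t`, `w_t`, `J_π` and `W̅_*`. -/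
def sqError (J : ℝ) (W : Set (EuclideanSpace ℝ (Fin d))) (Jt : ℝ)
    (w : EuclideanSpace ℝ (Fin d)) : ℝ :=
  (Jt - J) ^ 2 + Metric.infDist w W ^ 2

end Algorithm

end AvgTD

end

/-!
The error of the algorithm is `z = (y, u)` with `y = Ĵ - J_π` and `u` the component of `w - w₁`
orthogonal to `K`, where `w₁` is any solution of `A̅ w + b̅ = 0`. By the Dirichlet form of `P_λ`,
`⟨v, A̅ v⟩ ≤ 0` with equality exactly on `K`. Hence `A̅` maps onto `Kᗮ`, which contains `b̅`, so that
`W̅_* = w₁ + K` is nonempty and `y² + d(w, W̅_*)² = y² + ‖u‖²` (`Wstar_nonempty`, `infDist_Wstar`);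
and a large `c_β` absorbs the coupling term of the augmented form (`exists_augNegDef`). Because
differences of features annihilate `K`, the update acts on `z` alone (`errorVec_step`).

The Markovian noise is removed by a Poisson equation instead of a mixing-time argument. For
fixed `z`, the conditional mean of the rate of change of `½ (y² + ‖u‖²)` is affine in the trace: it has the form `φ(s) + ⟨ψ(s), e⟩`. On the
finite-dimensional space of such functions the Poisson equation of the chain `(S_t, e_t)` is
solvable, since the operators `1 - P + 𝟏 d_πᵀ` and `1 - λ P` are injective
(`exists_poisson_operator`), and the stationary mean is the augmented quadratic form
(`noiseFun_mean`). With the resulting corrector `G` (`exists_corrector`), the function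
`V_t = y² + ‖u‖² + 2 α_t G` satisfies
`𝔼 V_{t+1} ≤ (1 - c α_t) 𝔼 V_t + K α_t²` for large `t` (`exists_lyapunov`): the first-order
fluctuation cancels by the Poisson equation, and passing from `α_t` and `z_t` to `α_{t+1}` and
`z_{t+1}` in front of and inside `G` costs `O(α_t²)`.

Since `α c ≥ 3` for large `α`, Bernoulli's inequality turns this recursion into a transient of order
`t^(-⌊α c⌋)` and a noise term of order `(t + t₀)^(-(2 ξ - 1))` (`recursion_le`); here `t₀ ≥ 2` makes
the logarithm in the claim bounded below. Times at which the step size is not yet small are covered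
by a bound on the growth of the error along every path (`exists_errorAt_le`). The limit `J_π` comes
from the Poisson equation of the reward, whose partial sums telescope (`tendsto_meanReward`).
-/

noncomputable section

namespace AvgTD

set_option linter.unusedSectionVars false

/-! ### Finite Markov chains: stationary distributions and the Poisson equation -/

section Chain

variable {𝒮 : Type*} [Fintype 𝒮] [DecidableEq 𝒮] {P : Matrix 𝒮 𝒮 ℝ} {μ : 𝒮 → ℝ}

/-- A left fixed vector of `P` exists because `det (1 - P) = 0`; its absolute value is still fixed
since `|v| P ≥ |v|` entrywise and both sides have the same total mass. -/
lemma exists_isStationary [Nonempty 𝒮] (hP : P ∈ Matrix.rowStochastic ℝ 𝒮) :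
    ∃ μ, IsStationary P μ := by
  obtain ⟨hnn, h1⟩ := hP
  have hdet : (1 - P).det = 0 := by
    refine Matrix.exists_mulVec_eq_zero_iff.1 ⟨1, one_ne_zero, ?_⟩
    rw [Matrix.sub_mulVec, h1, Matrix.one_mulVec, sub_self]
  obtain ⟨v, hv0, hv⟩ := Matrix.exists_vecMul_eq_zero_iff.2 hdet
  have hvP : v ᵥ* P = v := by
    rw [Matrix.vecMul_sub, Matrix.vecMul_one, sub_eq_zero] at hv
    exact hv.symm
  have hrow : ∀ s, ∑ s', P s s' = 1 := fun s => by
    simpa [Matrix.mulVec, dotProduct] using congrFun h1 s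
  have hle : ∀ s', |v s'| ≤ ∑ s, |v s| * P s s' := fun s' => by
    calc |v s'| = |∑ s, v s * P s s'| := by
          conv_lhs => rw [← hvP]
          rfl
      _ ≤ ∑ s, |v s * P s s'| := Finset.abs_sum_le_sum_abs _ _
      _ = ∑ s, |v s| * P s s' := by simp only [abs_mul, abs_of_nonneg (hnn _ _)]
  have hsum : ∑ s', |v s'| = ∑ s', ∑ s, |v s| * P s s' := by
    rw [Finset.sum_comm]
    simp only [← Finset.mul_sum, hrow, mul_one]
  have heq := (Finset.sum_eq_sum_iff_of_le fun s' _ => hle s').1 hsum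
  have hpos : 0 < ∑ s, |v s| := by
    obtain ⟨s, hs⟩ := Function.ne_iff.1 hv0
    exact Finset.sum_pos' (fun _ _ => abs_nonneg _) ⟨s, Finset.mem_univ _, abs_pos.2 hs⟩
  refine ⟨fun s => |v s| / ∑ s, |v s|, fun s => by positivity, ?_, ?_⟩
  · rw [← Finset.sum_div, div_self hpos.ne']
  · ext s'
    simp only [Matrix.vecMul, dotProduct, div_mul_eq_mul_div, ← Finset.sum_div]
    rw [← heq s' (Finset.mem_univ _)]

lemma IsStationary.sum_mul_mulVec (hμ : IsStationary P μ) (f : 𝒮 → ℝ) :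
    ∑ s, μ s * (P *ᵥ f) s = ∑ s, μ s * f s := by
  change μ ⬝ᵥ (P *ᵥ f) = μ ⬝ᵥ f
  rw [Matrix.dotProduct_mulVec, hμ.invariant]

lemma IsStationary.pos (hμ : IsStationary P μ) (hirr : P.IsIrreducible) (s : 𝒮) : 0 < μ s := by
  have hpow : ∀ k, μ ᵥ* P ^ k = μ := fun k => by
    induction k with
    | zero => simp
    | succ k ih => rw [pow_succ, ← Matrix.vecMul_vecMul, ih, hμ.invariant]
  obtain ⟨s₀, -, hs₀⟩ : ∃ s ∈ Finset.univ, 0 < μ s := by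
    refine Finset.exists_lt_of_sum_lt (f := fun _ => (0 : ℝ)) ?_
    simp [hμ.sum_eq_one]
  obtain ⟨k, -, hk⟩ := (Matrix.isIrreducible_iff_exists_pow_pos hirr.nonneg).1 hirr s₀ s
  rw [← hpow k]
  refine (mul_pos hs₀ hk).trans_le ?_
  exact Finset.single_le_sum (f := fun i => μ i * (P ^ k) i s)
    (fun i _ => mul_nonneg (hμ.nonneg i) (Matrix.pow_apply_nonneg hirr.nonneg k i s))
    (Finset.mem_univ s₀)

/-- A function that does not change along the edges of an irreducible chain is constant. -/
lemma const_of_edges (hirr : P.IsIrreducible) {f : 𝒮 → ℝ}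
    (hf : ∀ s s', 0 < P s s' → f s = f s') (s s' : 𝒮) : f s = f s' := by
  obtain ⟨k, -, hk⟩ := (Matrix.isIrreducible_iff_exists_pow_pos hirr.nonneg).1 hirr s s'
  induction k generalizing s' with
  | zero =>
    by_contra hne
    have : s ≠ s' := fun h => hne (h ▸ rfl)
    simp [Matrix.one_apply_ne this] at hk
  | succ k ih =>
    rw [pow_succ, Matrix.mul_apply] at hk
    obtain ⟨u, -, hu⟩ := Finset.exists_lt_of_sum_lt (s := Finset.univ)
      (f := fun _ : 𝒮 => (0 : ℝ)) (by simpa using hk)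
    have h1 := Matrix.pow_apply_nonneg hirr.nonneg k s u
    have h2 := hirr.nonneg u s'
    have h3 : 0 < (P ^ k) s u := lt_of_le_of_ne h1 fun h => by simp [← h] at hu
    have h4 : 0 < P u s' := lt_of_le_of_ne h2 fun h => by simp [← h] at hu
    rw [ih u h3, hf u s' h4]

/-- The Dirichlet form of a chain with stationary vector `μ`, as a sum of squares. -/
lemma dirichlet_form {Q : Matrix 𝒮 𝒮 ℝ} (hQ : Q *ᵥ 1 = 1) (hμ : μ ᵥ* Q = μ) (f : 𝒮 → ℝ) :
    ∑ s, μ s * f s * ((Q *ᵥ f) s - f s) =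
      -(1 / 2) * ∑ s, ∑ s', μ s * Q s s' * (f s - f s') ^ 2 := by
  have hrow : ∀ s, ∑ s', Q s s' = 1 := fun s => by
    simpa [Matrix.mulVec, dotProduct] using congrFun hQ s
  have hcol : ∀ s', ∑ s, μ s * Q s s' = μ s' := fun s' => congrFun hμ s'
  have e1 : ∑ s, ∑ s', μ s * Q s s' * f s ^ 2 = ∑ s, μ s * f s ^ 2 := by
    refine Finset.sum_congr rfl fun s _ => ?_
    rw [← Finset.sum_mul, ← Finset.mul_sum, hrow, mul_one]
  have e2 : ∑ s, ∑ s', μ s * Q s s' * f s' ^ 2 = ∑ s, μ s * f s ^ 2 := by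
    rw [Finset.sum_comm]
    refine Finset.sum_congr rfl fun s _ => ?_
    rw [← Finset.sum_mul, hcol]
  have e3 : ∑ s, ∑ s', μ s * Q s s' * (f s * f s') = ∑ s, μ s * f s * (Q *ᵥ f) s := by
    refine Finset.sum_congr rfl fun s _ => ?_
    simp only [Matrix.mulVec, dotProduct, Finset.mul_sum]
    exact Finset.sum_congr rfl fun s' _ => by ring
  have e4 : ∑ s, ∑ s', μ s * Q s s' * (f s - f s') ^ 2 =
      ∑ s, μ s * f s ^ 2 + ∑ s, μ s * f s ^ 2 - 2 * ∑ s, μ s * f s * (Q *ᵥ f) s := by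
    rw [← e3]
    nth_rewrite 1 [← e1]
    rw [← e2]
    simp only [Finset.mul_sum, ← Finset.sum_add_distrib, ← Finset.sum_sub_distrib]
    exact Finset.sum_congr rfl fun s _ => Finset.sum_congr rfl fun s' _ => by ring
  rw [e4]
  simp only [mul_sub, Finset.sum_sub_distrib]
  have : ∑ s, μ s * f s * f s = ∑ s, μ s * f s ^ 2 :=
    Finset.sum_congr rfl fun s _ => by ring
  rw [this]
  ring

/-- If `Q` dominates a positive multiple of `P`, then a vanishing Dirichlet form of `Q` forces
constancy. The cases in use are `Q = P` and `Q = P_λ ≥ (1 - λ) P`. -/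
lemma const_of_dirichlet_nonneg {Q : Matrix 𝒮 𝒮 ℝ} (hirr : P.IsIrreducible)
    (hμP : IsStationary P μ) (hQ : Q *ᵥ 1 = 1) (hμ : μ ᵥ* Q = μ) {k : ℝ} (hk : 0 < k)
    (hle : ∀ s s', k * P s s' ≤ Q s s') {f : 𝒮 → ℝ}
    (hf : 0 ≤ ∑ s, μ s * f s * ((Q *ᵥ f) s - f s)) (s s' : 𝒮) : f s = f s' := by
  rw [dirichlet_form hQ hμ] at hf
  have hnn : ∀ s s', 0 ≤ μ s * Q s s' * (f s - f s') ^ 2 := fun s s' =>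
    mul_nonneg (mul_nonneg (hμP.nonneg s)
      ((mul_nonneg hk.le (hirr.nonneg s s')).trans (hle s s'))) (sq_nonneg _)
  have h0 : ∑ s, ∑ s', μ s * Q s s' * (f s - f s') ^ 2 = 0 :=
    le_antisymm (by linarith) (Finset.sum_nonneg fun s _ => Finset.sum_nonneg fun s' _ => hnn s s')
  refine const_of_edges hirr (fun s s' hP => ?_) s s'
  have h1 := (Finset.sum_eq_zero_iff_of_nonneg
    fun s _ => Finset.sum_nonneg fun s' _ => hnn s s').1 h0 s (Finset.mem_univ _)
  have h2 := (Finset.sum_eq_zero_iff_of_nonneg fun s' _ => hnn s s').1 h1 s' (Finset.mem_univ _)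
  have h3 : 0 < μ s * Q s s' := mul_pos (hμP.pos hirr s) ((mul_pos hk hP).trans_le (hle s s'))
  have := (mul_eq_zero.1 h2).resolve_left h3.ne'
  linarith [pow_eq_zero_iff (two_ne_zero) |>.1 this]

/-- `1 - P + 𝟏 μᵀ` is injective. This is the Fredholm alternative for the Poisson equation of an
irreducible chain. -/
lemma eq_zero_of_poisson (hP : P *ᵥ 1 = 1) (hirr : P.IsIrreducible) (hμ : IsStationary P μ)
    {g : 𝒮 → ℝ} (hg : ∀ s, g s - (P *ᵥ g) s + ∑ s', μ s' * g s' = 0) : g = 0 := by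
  have hm : ∑ s', μ s' * g s' = 0 := by
    have : ∑ s, μ s * (g s - (P *ᵥ g) s + ∑ s', μ s' * g s') = 0 := by simp [hg]
    simp only [mul_add, mul_sub, Finset.sum_add_distrib, Finset.sum_sub_distrib,
      hμ.sum_mul_mulVec, ← Finset.sum_mul, hμ.sum_eq_one] at this
    linarith
  have hc : ∀ s s', g s = g s' := by
    refine const_of_dirichlet_nonneg hirr hμ hP hμ.invariant one_pos (by simp) ?_
    refine le_of_eq (Eq.symm (Finset.sum_eq_zero fun s _ => ?_))
    have := hg s
    rw [hm] at this
    rw [show (P *ᵥ g) s - g s = 0 by linarith, mul_zero]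
  ext s
  have : ∑ s', μ s' * g s' = g s := by
    rw [Finset.sum_congr rfl fun s' _ => by rw [hc s' s], ← Finset.sum_mul, hμ.sum_eq_one, one_mul]
  simpa [this] using hm

/-- `ψ = λ P ψ` has only the zero solution, since `λ P` contracts the maximum norm. -/
lemma eq_zero_of_eq_lam_average {E : Type*} [NormedAddCommGroup E] [NormedSpace ℝ E]
    (hP : P ∈ Matrix.rowStochastic ℝ 𝒮) {lam : ℝ} (h0 : 0 ≤ lam) (h1 : lam < 1) {ψ : 𝒮 → E}
    (hψ : ∀ s, ψ s = lam • ∑ s', P s s' • ψ s') : ψ = 0 := by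
  have hle : ‖ψ‖ ≤ lam * ‖ψ‖ := by
    refine (pi_norm_le_iff_of_nonneg (by positivity)).2 fun s => ?_
    rw [hψ s, norm_smul, Real.norm_of_nonneg h0]
    refine mul_le_mul_of_nonneg_left ?_ h0
    calc ‖∑ s', P s s' • ψ s'‖ ≤ ∑ s', P s s' * ‖ψ‖ := by
          refine norm_sum_le_of_le _ fun s' _ => ?_
          rw [norm_smul, Real.norm_of_nonneg (hP.1 _ _)]
          exact mul_le_mul_of_nonneg_left (norm_le_pi_norm _ _) (hP.1 _ _)
      _ = ‖ψ‖ := by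
          rw [← Finset.sum_mul, Matrix.sum_row_of_mem_rowStochastic hP, one_mul]
  refine norm_eq_zero.1 (le_antisymm ?_ (norm_nonneg _))
  nlinarith [norm_nonneg ψ]

end Chain

/-! ### Discounted sums along a finite chain -/

section Discounted

variable {𝒮 : Type*} [Fintype 𝒮] [DecidableEq 𝒮] {P : Matrix 𝒮 𝒮 ℝ} {μ : 𝒮 → ℝ} {lam : ℝ}

lemma abs_mulVec_le (hP : P ∈ Matrix.rowStochastic ℝ 𝒮) (f : 𝒮 → ℝ) (s : 𝒮) :
    |(P *ᵥ f) s| ≤ ‖f‖ := by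
  calc |(P *ᵥ f) s| ≤ ∑ s', P s s' * ‖f‖ := by
        refine (Finset.abs_sum_le_sum_abs _ _).trans (Finset.sum_le_sum fun s' _ => ?_)
        rw [abs_mul, abs_of_nonneg (hP.1 _ _)]
        exact mul_le_mul_of_nonneg_left (norm_le_pi_norm f s') (hP.1 _ _)
    _ = ‖f‖ := by rw [← Finset.sum_mul, Matrix.sum_row_of_mem_rowStochastic hP, one_mul]

lemma summable_lam_pow_mul (h0 : 0 ≤ lam) (h1 : lam < 1) {a : ℕ → ℝ} {C : ℝ}
    (ha : ∀ k, |a k| ≤ C) : Summable fun k => lam ^ k * a k := by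
  refine Summable.of_norm_bounded ((summable_geometric_of_lt_one h0 h1).mul_right C) fun k => ?_
  rw [norm_mul, Real.norm_of_nonneg (pow_nonneg h0 k)]
  exact mul_le_mul_of_nonneg_left (ha k) (pow_nonneg h0 k)

lemma summable_discounted (hP : P ∈ Matrix.rowStochastic ℝ 𝒮) (h0 : 0 ≤ lam) (h1 : lam < 1)
    (f : 𝒮 → ℝ) (s : 𝒮) : Summable fun k : ℕ => lam ^ k * ((P ^ k) *ᵥ f) s :=
  summable_lam_pow_mul h0 h1 fun k => abs_mulVec_le (pow_mem hP k) f s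

lemma rewardVecLam_add_smul (hP : P ∈ Matrix.rowStochastic ℝ 𝒮) (h0 : 0 ≤ lam) (h1 : lam < 1)
    (f g : 𝒮 → ℝ) (a : ℝ) (s : 𝒮) :
    rewardVecLam P (f + a • g) lam s = rewardVecLam P f lam s + a * rewardVecLam P g lam s := by
  unfold rewardVecLam
  rw [← tsum_mul_left, ← (summable_discounted hP h0 h1 f s).tsum_add
    ((summable_discounted hP h0 h1 g s).mul_left a)]
  refine tsum_congr fun k => ?_
  rw [Matrix.mulVec_add, Matrix.mulVec_smul]
  simp only [Pi.add_apply, Pi.smul_apply, smul_eq_mul]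
  ring

lemma rewardVecLam_one (hP : P ∈ Matrix.rowStochastic ℝ 𝒮) (h0 : 0 ≤ lam) (h1 : lam < 1)
    (s : 𝒮) : rewardVecLam P 1 lam s = (1 - lam)⁻¹ := by
  unfold rewardVecLam
  rw [← tsum_geometric_of_lt_one h0 h1]
  refine tsum_congr fun k => ?_
  rw [(pow_mem hP k).2]
  simp

/-- The resolvent equation `Γ = f + λ P Γ` of the discounted sum `Γ = ∑ λᵏ Pᵏ f`. -/
lemma rewardVecLam_eq (hP : P ∈ Matrix.rowStochastic ℝ 𝒮) (h0 : 0 ≤ lam) (h1 : lam < 1)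
    (f : 𝒮 → ℝ) (s : 𝒮) :
    rewardVecLam P f lam s = f s + lam * ∑ s', P s s' * rewardVecLam P f lam s' := by
  have hs : ∀ s', Summable fun k : ℕ => P s s' * (lam ^ k * ((P ^ k) *ᵥ f) s') := fun s' =>
    (summable_discounted hP h0 h1 f s').mul_left _
  unfold rewardVecLam
  rw [(summable_discounted hP h0 h1 f s).tsum_eq_zero_add]
  simp only [← tsum_mul_left]
  rw [← Summable.tsum_finsetSum fun s' _ => hs s', ← tsum_mul_left]
  congr 1
  · simp
  · refine tsum_congr fun k => ?_
    rw [pow_succ' P, ← Matrix.mulVec_mulVec]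
    change lam ^ (k + 1) * ∑ s', P s s' * ((P ^ k) *ᵥ f) s' = _
    rw [Finset.mul_sum, Finset.mul_sum]
    exact Finset.sum_congr rfl fun s' _ => by ring

lemma transMatrixLam_mulVec (hP : P ∈ Matrix.rowStochastic ℝ 𝒮) (h0 : 0 ≤ lam) (h1 : lam < 1)
    (f : 𝒮 → ℝ) (s : 𝒮) :
    (transMatrixLam P lam *ᵥ f) s =
      (1 - lam) * ∑' m : ℕ, lam ^ m * ((P ^ (m + 1)) *ᵥ f) s := by
  have hs : ∀ s', Summable fun m : ℕ => lam ^ m * (P ^ (m + 1)) s s' := fun s' =>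
    summable_lam_pow_mul (C := 1) h0 h1 fun m => by
      rw [abs_of_nonneg ((pow_mem hP (m + 1)).1 _ _)]
      exact Matrix.le_one_of_mem_rowStochastic (pow_mem hP (m + 1))
  simp only [transMatrixLam, Matrix.mulVec, dotProduct, Matrix.of_apply, mul_assoc]
  rw [← Finset.mul_sum]
  congr 1
  simp only [← tsum_mul_right]
  rw [← Summable.tsum_finsetSum fun s' _ => (hs s').mul_right _]
  refine tsum_congr fun m => ?_
  rw [Finset.mul_sum]
  exact Finset.sum_congr rfl fun s' _ => by ring

/-- `∑ λᵏ Pᵏ (P - 1) = P_λ - 1`, by summation by parts. -/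
lemma rewardVecLam_mulVec_sub (hP : P ∈ Matrix.rowStochastic ℝ 𝒮) (h0 : 0 ≤ lam) (h1 : lam < 1)
    (f : 𝒮 → ℝ) (s : 𝒮) :
    rewardVecLam P (P *ᵥ f - f) lam s = (transMatrixLam P lam *ᵥ f) s - f s := by
  rw [transMatrixLam_mulVec hP h0 h1]
  have hs := summable_discounted hP h0 h1 f s
  have hs' : Summable fun k : ℕ => lam ^ k * ((P ^ (k + 1)) *ᵥ f) s :=
    summable_lam_pow_mul h0 h1 fun k => abs_mulVec_le (pow_mem hP (k + 1)) f s
  have e1 : ∑' k : ℕ, lam ^ k * ((P ^ k) *ᵥ f) s =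
      f s + lam * ∑' k : ℕ, lam ^ k * ((P ^ (k + 1)) *ᵥ f) s := by
    rw [hs.tsum_eq_zero_add, ← tsum_mul_left]
    congr 1
    · simp
    · exact tsum_congr fun k => by ring
  have e2 : rewardVecLam P (P *ᵥ f - f) lam s =
      ∑' k : ℕ, lam ^ k * ((P ^ (k + 1)) *ᵥ f) s - ∑' k : ℕ, lam ^ k * ((P ^ k) *ᵥ f) s := by
    rw [← hs'.tsum_sub hs]
    refine tsum_congr fun k => ?_
    rw [Matrix.mulVec_sub, Matrix.mulVec_mulVec, ← pow_succ, Pi.sub_apply]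
    ring
  rw [e2, e1]
  ring

lemma transMatrixLam_mulVec_one (hP : P ∈ Matrix.rowStochastic ℝ 𝒮) (h0 : 0 ≤ lam)
    (h1 : lam < 1) : transMatrixLam P lam *ᵥ 1 = 1 := by
  ext s
  rw [transMatrixLam_mulVec hP h0 h1]
  have : ∀ m : ℕ, lam ^ m * ((P ^ (m + 1)) *ᵥ 1) s = lam ^ m := fun m => by
    rw [(pow_mem hP (m + 1)).2]
    simp
  simp only [this]
  rw [tsum_geometric_of_lt_one h0 h1, mul_inv_cancel₀ (by linarith)]
  rfl

lemma IsStationary.vecMul_transMatrixLam (hμ : IsStationary P μ)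
    (hP : P ∈ Matrix.rowStochastic ℝ 𝒮) (h0 : 0 ≤ lam) (h1 : lam < 1) :
    μ ᵥ* transMatrixLam P lam = μ := by
  have hpow : ∀ k, μ ᵥ* P ^ k = μ := fun k => by
    induction k with
    | zero => simp
    | succ k ih => rw [pow_succ, ← Matrix.vecMul_vecMul, ih, hμ.invariant]
  ext s'
  rw [← dotProduct_single_one (μ ᵥ* _), ← Matrix.dotProduct_mulVec, dotProduct]
  have hs : ∀ s, Summable fun m : ℕ => lam ^ m * ((P ^ (m + 1)) *ᵥ Pi.single s' 1) s := fun s =>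
    summable_lam_pow_mul h0 h1 fun k => abs_mulVec_le (pow_mem hP (k + 1)) _ s
  have : ∀ m : ℕ, ∑ s, μ s * (lam ^ m * ((P ^ (m + 1)) *ᵥ Pi.single s' 1) s) =
      lam ^ m * μ s' := fun m => by
    have h2 : μ ⬝ᵥ ((P ^ (m + 1)) *ᵥ Pi.single s' 1) = μ s' := by
      rw [Matrix.dotProduct_mulVec, hpow, dotProduct_single_one]
    rw [← h2, dotProduct, Finset.mul_sum]
    exact Finset.sum_congr rfl fun s _ => by ring
  simp only [transMatrixLam_mulVec hP h0 h1, mul_left_comm (μ _)]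
  rw [← Finset.mul_sum]
  simp only [← tsum_mul_left]
  rw [← Summable.tsum_finsetSum fun s _ => (hs s).mul_left _]
  simp only [this]
  rw [tsum_mul_left.symm, tsum_mul_left, tsum_mul_right, tsum_geometric_of_lt_one h0 h1,
    ← mul_assoc, mul_inv_cancel₀ (by linarith), one_mul]

lemma one_sub_mul_le_transMatrixLam (hP : P ∈ Matrix.rowStochastic ℝ 𝒮) (h0 : 0 ≤ lam)
    (h1 : lam < 1) (s s' : 𝒮) : (1 - lam) * P s s' ≤ transMatrixLam P lam s s' := by
  have hs : Summable fun m : ℕ => lam ^ m * (P ^ (m + 1)) s s' :=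
    summable_lam_pow_mul (C := 1) h0 h1 fun m => by
      rw [abs_of_nonneg ((pow_mem hP (m + 1)).1 _ _)]
      exact Matrix.le_one_of_mem_rowStochastic (pow_mem hP (m + 1))
  refine mul_le_mul_of_nonneg_left ?_ (by linarith)
  have := hs.le_tsum 0 fun m _ => mul_nonneg (pow_nonneg h0 m) ((pow_mem hP (m + 1)).1 _ _)
  simpa using this

end Discounted

/-! ### The mean linear system -/

section MeanSystem

variable {𝒮 𝒜 : Type*} [Fintype 𝒮] [DecidableEq 𝒮] [Fintype 𝒜] {d : ℕ}
  {M : MDP 𝒮 𝒜} {π : Policy 𝒮 𝒜} {x : 𝒮 → EuclideanSpace ℝ (Fin d)} {lam : ℝ}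

lemma transMatrix_mem_rowStochastic (M : MDP 𝒮 𝒜) (π : Policy 𝒮 𝒜) :
    transMatrix M π ∈ Matrix.rowStochastic ℝ 𝒮 := by
  refine Matrix.mem_rowStochastic_iff_sum.2 ⟨fun s s' => ?_, fun s => ?_⟩
  · exact Finset.sum_nonneg fun a _ => mul_nonneg (π.prob_nonneg s a) (M.p_nonneg s a s')
  · simp only [transMatrix, Matrix.of_apply]
    rw [Finset.sum_comm]
    simp only [← Finset.mul_sum, M.p_sum, mul_one, π.prob_sum]

lemma MDP.nonempty (M : MDP 𝒮 𝒜) : Nonempty 𝒮 := by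
  by_contra h
  rw [not_nonempty_iff] at h
  simpa using M.p₀_sum

lemma isStationary_stationaryDist (M : MDP 𝒮 𝒜) (π : Policy 𝒮 𝒜) :
    IsStationary (transMatrix M π) (stationaryDist (transMatrix M π)) :=
  haveI := M.nonempty
  Classical.epsilon_spec (exists_isStationary (transMatrix_mem_rowStochastic M π))

lemma featureMatrix_mulVec (x : 𝒮 → EuclideanSpace ℝ (Fin d)) (w : EuclideanSpace ℝ (Fin d)) :
    featureMatrix x *ᵥ (fun i => w i) = fun s => inner ℝ (x s) w := by
  ext s
  rw [real_inner_comm]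
  simp [Matrix.mulVec, dotProduct, featureMatrix, PiLp.inner_apply]

lemma dotProduct_transpose_mul_diagonal (μ f : 𝒮 → ℝ) (v : EuclideanSpace ℝ (Fin d)) :
    (fun i => v i) ⬝ᵥ (((featureMatrix x)ᵀ * Matrix.diagonal μ) *ᵥ f) =
      ∑ s, μ s * inner ℝ (x s) v * f s := by
  rw [← Matrix.mulVec_mulVec, Matrix.dotProduct_mulVec, Matrix.vecMul_transpose,
    featureMatrix_mulVec]
  simp only [dotProduct, Matrix.mulVec_diagonal]
  exact Finset.sum_congr rfl fun s _ => by ring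

lemma Abar_mulVec (w : EuclideanSpace ℝ (Fin d)) :
    Abar M π x lam *ᵥ (fun i => w i) =
      ((featureMatrix x)ᵀ * Matrix.diagonal (stationaryDist (transMatrix M π))) *ᵥ
        fun s => (transMatrixLam (transMatrix M π) lam *ᵥ fun s' => inner ℝ (x s') w) s
          - inner ℝ (x s) w := by
  rw [Abar, ← Matrix.mulVec_mulVec, ← Matrix.mulVec_mulVec, featureMatrix_mulVec,
    Matrix.sub_mulVec, Matrix.one_mulVec]
  rfl

lemma inner_Abar (v w : EuclideanSpace ℝ (Fin d)) :
    inner ℝ v (Matrix.toEuclideanLin (Abar M π x lam) w) =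
      ∑ s, stationaryDist (transMatrix M π) s * inner ℝ (x s) v *
        ((transMatrixLam (transMatrix M π) lam *ᵥ fun s' => inner ℝ (x s') w) s
          - inner ℝ (x s) w) := by
  rw [← dotProduct_transpose_mul_diagonal, ← Abar_mulVec, real_inner_comm]
  simp only [PiLp.inner_apply, dotProduct]
  rfl

lemma inner_traceMean (h0 : 0 ≤ lam) (h1 : lam < 1) (v : EuclideanSpace ℝ (Fin d)) :
    inner ℝ v (traceMean M π x lam) =
      (1 - lam)⁻¹ * ∑ s, stationaryDist (transMatrix M π) s * inner ℝ (x s) v := by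
  rw [traceMean, (summable_geometric_of_lt_one h0 h1).tsum_smul_const,
    tsum_geometric_of_lt_one h0 h1, real_inner_smul_right, inner_sum]
  simp only [real_inner_smul_right, real_inner_comm]

/-- The defining equation of `W̅_*`, tested against all weight vectors. -/
lemma mem_Wstar_iff {J : ℝ} {w : EuclideanSpace ℝ (Fin d)} :
    w ∈ Wstar M π x lam J ↔ ∀ v : EuclideanSpace ℝ (Fin d),
      ∑ s, stationaryDist (transMatrix M π) s * inner ℝ (x s) v *
        ((transMatrixLam (transMatrix M π) lam *ᵥ fun s' => inner ℝ (x s') w) s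
          - inner ℝ (x s) w) +
      ∑ s, stationaryDist (transMatrix M π) s * inner ℝ (x s) v *
        (rewardVecLam (transMatrix M π) (rewardVec M π) lam s - J / (1 - lam)) = 0 := by
  simp only [← dotProduct_transpose_mul_diagonal, ← dotProduct_add, ← Abar_mulVec]
  change Abar M π x lam *ᵥ (fun i => w i) + bbar M π x lam J = 0 ↔ ∀ v : EuclideanSpace ℝ (Fin d),
    (fun i => v i) ⬝ᵥ (Abar M π x lam *ᵥ (fun i => w i) + bbar M π x lam J) = 0
  refine ⟨fun h v => by rw [h, dotProduct_zero], fun h => ?_⟩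
  ext i
  simpa [dotProduct] using h (EuclideanSpace.single i 1)

lemma mem_constKer_of_inner_Abar_nonneg (hirr : (transMatrix M π).IsIrreducible) (h0 : 0 ≤ lam) (h1 : lam < 1)
    {v : EuclideanSpace ℝ (Fin d)}
    (hv : 0 ≤ inner ℝ v (Matrix.toEuclideanLin (Abar M π x lam) v)) : v ∈ constKer x := by
  have hP := transMatrix_mem_rowStochastic M π
  have hμ := isStationary_stationaryDist M π
  rw [inner_Abar] at hv
  obtain ⟨s₀⟩ := M.nonempty
  exact ⟨inner ℝ (x s₀) v, fun s => const_of_dirichlet_nonneg hirr hμ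
    (transMatrixLam_mulVec_one hP h0 h1) (hμ.vecMul_transMatrixLam hP h0 h1)
    (sub_pos.2 h1) (one_sub_mul_le_transMatrixLam hP h0 h1) hv s s₀⟩

lemma inner_Abar_of_mem_constKer (h0 : 0 ≤ lam) (h1 : lam < 1)
    {v : EuclideanSpace ℝ (Fin d)} (hv : v ∈ constKer x) (w : EuclideanSpace ℝ (Fin d)) :
    inner ℝ v (Matrix.toEuclideanLin (Abar M π x lam) w) = 0 := by
  have hP := transMatrix_mem_rowStochastic M π
  have hμ := isStationary_stationaryDist M π
  obtain ⟨c, hc⟩ := hv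
  have h : stationaryDist (transMatrix M π) ⬝ᵥ
      (transMatrixLam (transMatrix M π) lam *ᵥ fun s => inner ℝ (x s) w) =
      stationaryDist (transMatrix M π) ⬝ᵥ fun s => inner ℝ (x s) w := by
    rw [Matrix.dotProduct_mulVec, hμ.vecMul_transMatrixLam hP h0 h1]
  simp only [dotProduct] at h
  simp only [inner_Abar, hc, mul_sub, Finset.sum_sub_distrib, mul_right_comm _ c,
    ← Finset.sum_mul, h, sub_self, zero_mul]

lemma transMatrixLam_mulVec_of_mem_constKer (h0 : 0 ≤ lam) (h1 : lam < 1)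
    {v : EuclideanSpace ℝ (Fin d)} (hv : v ∈ constKer x) (s : 𝒮) :
    (transMatrixLam (transMatrix M π) lam *ᵥ fun s' => inner ℝ (x s') v) s = inner ℝ (x s) v := by
  obtain ⟨c, hc⟩ := hv
  have : (fun s' => inner ℝ (x s') v) = c • (1 : 𝒮 → ℝ) := by
    ext s'
    simp [hc]
  rw [this, Matrix.mulVec_smul,
    transMatrixLam_mulVec_one (transMatrix_mem_rowStochastic M π) h0 h1, hc]
  simp

/-- The stationary mean reward `∑ d_π(s) r_π(s)`, the value of the average reward. -/
def statReward (M : MDP 𝒮 𝒜) (π : Policy 𝒮 𝒜) : ℝ :=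
  ∑ s, stationaryDist (transMatrix M π) s * rewardVec M π s

lemma sum_stationaryDist_mul_rewardVecLam (h0 : 0 ≤ lam) (h1 : lam < 1) :
    ∑ s, stationaryDist (transMatrix M π) s *
      (rewardVecLam (transMatrix M π) (rewardVec M π) lam s - statReward M π / (1 - lam)) = 0 := by
  have hP := transMatrix_mem_rowStochastic M π
  have hμ := isStationary_stationaryDist M π
  set Γ := rewardVecLam (transMatrix M π) (rewardVec M π) lam with hΓ
  have h : ∑ s, stationaryDist (transMatrix M π) s * Γ s =
      statReward M π + lam * ∑ s, stationaryDist (transMatrix M π) s * Γ s := by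
    conv_rhs => rw [← hμ.sum_mul_mulVec, statReward, Finset.mul_sum, ← Finset.sum_add_distrib]
    refine Finset.sum_congr rfl fun s _ => ?_
    rw [hΓ, rewardVecLam_eq hP h0 h1]
    simp only [Matrix.mulVec, dotProduct]
    ring
  simp only [mul_sub, Finset.sum_sub_distrib, ← Finset.sum_mul, hμ.sum_eq_one, one_mul]
  rw [sub_eq_zero, eq_div_iff (by linarith)]
  linarith

/-- The range of `A̅` is `Kᗮ`, which contains `b̅`. Surjectivity is read off from the injectivity of
`A̅ - Π_K`. -/
lemma Wstar_nonempty (hirr : (transMatrix M π).IsIrreducible) (h0 : 0 ≤ lam) (h1 : lam < 1) :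
    (Wstar M π x lam (statReward M π)).Nonempty := by
  set T := Matrix.toEuclideanLin (Abar M π x lam)
  set U : EuclideanSpace ℝ (Fin d) →ₗ[ℝ] EuclideanSpace ℝ (Fin d) :=
    T - (constKer x).starProjection.toLinearMap
  have hproj : ∀ v, inner ℝ ((constKer x).starProjection v) (T v) = 0 := fun v =>
    inner_Abar_of_mem_constKer h0 h1 (Submodule.starProjection_apply_mem _ v) v
  have hinj : Function.Injective U := by
    refine (injective_iff_map_eq_zero U).2 fun v hv => ?_
    have hTv : T v = (constKer x).starProjection v := sub_eq_zero.1 hv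
    have hz : (constKer x).starProjection v = 0 := by
      have := hproj v
      rwa [hTv, inner_self_eq_zero] at this
    have hvK : v ∈ constKer x := mem_constKer_of_inner_Abar_nonneg hirr h0 h1
      (by change 0 ≤ inner ℝ v (T v); rw [hTv, hz, inner_zero_right])
    rwa [Submodule.starProjection_eq_self_iff.2 hvK] at hz
  set b : EuclideanSpace ℝ (Fin d) := WithLp.toLp 2 (bbar M π x lam (statReward M π))
  have hb : ∀ v, inner ℝ v b = ∑ s, stationaryDist (transMatrix M π) s * inner ℝ (x s) v *
      (rewardVecLam (transMatrix M π) (rewardVec M π) lam s - statReward M π / (1 - lam)) :=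
    fun v => by
      rw [← dotProduct_transpose_mul_diagonal, real_inner_comm]
      simp only [PiLp.inner_apply, dotProduct]
      rfl
  have hbK : ∀ v ∈ constKer x, inner ℝ v b = 0 := by
    rintro v ⟨c, hc⟩
    rw [hb]
    simp only [hc, mul_right_comm _ c, ← Finset.sum_mul, sum_stationaryDist_mul_rewardVecLam h0 h1,
      zero_mul]
  obtain ⟨w, hw⟩ := (LinearMap.injective_iff_surjective.1 hinj) (-b)
  have hw' : T w - (constKer x).starProjection w = -b := hw
  have hz : (constKer x).starProjection w = 0 := by
    have := congrArg (inner ℝ ((constKer x).starProjection w)) hw'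
    rw [inner_sub_right, hproj, inner_neg_right,
      hbK _ (Submodule.starProjection_apply_mem _ w), zero_sub, neg_zero, neg_eq_zero,
      inner_self_eq_zero] at this
    exact this
  rw [hz, sub_zero] at hw'
  refine ⟨w, mem_Wstar_iff.2 fun v => ?_⟩
  rw [← inner_Abar, ← hb, ← inner_add_right]
  change inner ℝ v (T w + b) = 0
  rw [hw', neg_add_cancel, inner_zero_right]

/-- `W̅_* = w_* + K` for every `w_* ∈ W̅_*`. -/
lemma mem_Wstar_iff_sub_mem (hirr : (transMatrix M π).IsIrreducible) (h0 : 0 ≤ lam)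
    (h1 : lam < 1) {J : ℝ} {w₁ w : EuclideanSpace ℝ (Fin d)} (hw₁ : w₁ ∈ Wstar M π x lam J) :
    w ∈ Wstar M π x lam J ↔ w - w₁ ∈ constKer x := by
  have key : ∀ v, inner ℝ v (Matrix.toEuclideanLin (Abar M π x lam) (w - w₁)) =
      inner ℝ v (Matrix.toEuclideanLin (Abar M π x lam) w) -
        inner ℝ v (Matrix.toEuclideanLin (Abar M π x lam) w₁) := fun v => by
    rw [map_sub, inner_sub_right]
  rw [mem_Wstar_iff] at hw₁ ⊢
  simp only [← inner_Abar] at hw₁ ⊢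
  constructor
  · intro hw
    refine mem_constKer_of_inner_Abar_nonneg hirr h0 h1 ?_
    rw [key]
    linarith [hw (w - w₁), hw₁ (w - w₁)]
  · intro hK v
    have : inner ℝ v (Matrix.toEuclideanLin (Abar M π x lam) (w - w₁)) = 0 := by
      rw [inner_Abar]
      exact Finset.sum_eq_zero fun s _ => by
        rw [transMatrixLam_mulVec_of_mem_constKer h0 h1 hK, sub_self, mul_zero]
    rw [key] at this
    linarith [hw₁ v]

lemma infDist_Wstar (hirr : (transMatrix M π).IsIrreducible) (h0 : 0 ≤ lam) (h1 : lam < 1)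
    {J : ℝ} {w₁ : EuclideanSpace ℝ (Fin d)} (hw₁ : w₁ ∈ Wstar M π x lam J)
    (w : EuclideanSpace ℝ (Fin d)) :
    Metric.infDist w (Wstar M π x lam J) = ‖(constKer x)ᗮ.starProjection (w - w₁)‖ := by
  refine le_antisymm ?_ ((Metric.le_infDist ⟨w₁, hw₁⟩).2 fun {w'} hw' => ?_)
  · have hmem : w - (constKer x)ᗮ.starProjection (w - w₁) ∈ Wstar M π x lam J := by
      rw [mem_Wstar_iff_sub_mem hirr h0 h1 hw₁, sub_right_comm,
        Submodule.starProjection_orthogonal_val, sub_sub_cancel]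
      exact Submodule.starProjection_apply_mem _ _
    simpa [dist_eq_norm] using Metric.infDist_le_dist_of_mem (x := w) hmem
  · have h := (mem_Wstar_iff_sub_mem hirr h0 h1 hw₁).1 hw'
    have h2 : (constKer x)ᗮ.starProjection (w - w₁) = (constKer x)ᗮ.starProjection (w - w') := by
      rw [← sub_eq_zero, ← map_sub, sub_sub_sub_cancel_left,
        Submodule.starProjection_orthogonal_apply_eq_zero h]
    rw [h2, dist_eq_norm]
    exact Submodule.norm_starProjection_apply_le _ _

lemma augForm_eq {cβ y : ℝ} {v : EuclideanSpace ℝ (Fin d)} (hv : v ∈ (constKer x)ᗮ) :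
    augForm M π x lam cβ y v = -cβ * y ^ 2 +
      (inner ℝ v (Matrix.toEuclideanLin (Abar M π x lam) v) -
        y * inner ℝ v (traceMean M π x lam)) := by
  rw [augForm, ← Submodule.inner_starProjection_left_eq_right,
    Submodule.starProjection_eq_self_iff.2 hv, inner_sub_right, real_inner_smul_right]
  ring

/-- `A̅` is negative definite on `Kᗮ`: the form is negative off `0`, hence bounded away from zero on
the compact unit sphere. -/
lemma exists_inner_Abar_le (hirr : (transMatrix M π).IsIrreducible) (h0 : 0 ≤ lam)
    (h1 : lam < 1) : ∃ η : ℝ, 0 < η ∧ ∀ v ∈ (constKer x)ᗮ,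
      inner ℝ v (Matrix.toEuclideanLin (Abar M π x lam) v) ≤ -η * ‖v‖ ^ 2 := by
  set T := Matrix.toEuclideanLin (Abar M π x lam)
  set f : EuclideanSpace ℝ (Fin d) → ℝ := fun v => inner ℝ v (T v)
  have hf : Continuous f := continuous_id.inner T.continuous_of_finiteDimensional
  have hneg : ∀ v ∈ (constKer x)ᗮ, v ≠ 0 → f v < 0 := fun v hv hne => by
    by_contra hcon
    have hK := mem_constKer_of_inner_Abar_nonneg hirr h0 h1 (not_lt.1 hcon)
    exact hne (inner_self_eq_zero.1 ((Submodule.mem_orthogonal _ v).1 hv v hK))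
  have hcomp : IsCompact (Metric.sphere (0 : EuclideanSpace ℝ (Fin d)) 1 ∩ (constKer x)ᗮ) :=
    (isCompact_sphere _ _).inter_right (Submodule.closed_of_finiteDimensional _)
  obtain ⟨η, hη, hle⟩ : ∃ η : ℝ, 0 < η ∧ ∀ v ∈ Metric.sphere (0 : EuclideanSpace ℝ (Fin d)) 1 ∩
      (constKer x)ᗮ, f v ≤ -η := by
    rcases (Metric.sphere (0 : EuclideanSpace ℝ (Fin d)) 1 ∩ (constKer x)ᗮ).eq_empty_or_nonempty
      with he | hne
    · exact ⟨1, one_pos, by simp [he]⟩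
    · obtain ⟨v₀, hv₀, hmax⟩ := hcomp.exists_isMaxOn hne hf.continuousOn
      refine ⟨-f v₀, neg_pos.2 (hneg v₀ hv₀.2 ?_), fun v hv => by simpa using hmax hv⟩
      rintro rfl
      simp at hv₀
  refine ⟨η, hη, fun v hv => ?_⟩
  rcases eq_or_ne v 0 with rfl | hne
  · simp
  have hn : 0 < ‖v‖ := norm_pos_iff.2 hne
  have h := hle (‖v‖⁻¹ • v) ⟨by simp [norm_smul, hn.ne'], Submodule.smul_mem _ _ hv⟩
  have h2 : f (‖v‖⁻¹ • v) = (‖v‖ ^ 2)⁻¹ * f v := by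
    simp only [f, map_smul, real_inner_smul_left, real_inner_smul_right]
    ring
  rw [h2, inv_mul_le_iff₀ (by positivity)] at h
  change f v ≤ _
  linarith

lemma exists_augNegDef (hirr : (transMatrix M π).IsIrreducible) (h0 : 0 ≤ lam)
    (h1 : lam < 1) : ∃ cβ₀ : ℝ, 0 < cβ₀ ∧ ∀ cβ : ℝ, cβ₀ ≤ cβ →
      ∃ c : ℝ, 0 < c ∧ AugNegDef M π x lam cβ c := by
  obtain ⟨η, hη, hle⟩ := exists_inner_Abar_le (x := x) hirr h0 h1
  set q := traceMean M π x lam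
  -- The cross term `y ⟨v, q⟩` is absorbed by `(η / 2) ‖v‖² + ‖q‖² y² / (2 η)`.
  refine ⟨η / 2 + ‖q‖ ^ 2 / (2 * η), by positivity, fun cβ hcβ => ⟨η / 2, by positivity, ?_⟩⟩
  intro y v hv
  rw [augForm_eq hv]
  have h := hle v hv
  have hcs : |y * inner ℝ v q| ≤ |y| * (‖v‖ * ‖q‖) := by
    rw [abs_mul]
    exact mul_le_mul_of_nonneg_left (abs_real_inner_le_norm v q) (abs_nonneg y)
  have hyoung : |y| * (‖v‖ * ‖q‖) ≤ η / 2 * ‖v‖ ^ 2 + ‖q‖ ^ 2 / (2 * η) * y ^ 2 := by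
    rw [← sub_nonneg]
    have : η / 2 * ‖v‖ ^ 2 + ‖q‖ ^ 2 / (2 * η) * y ^ 2 - |y| * (‖v‖ * ‖q‖) =
        (η * ‖v‖ - ‖q‖ * |y|) ^ 2 / (2 * η) := by
      rw [← sq_abs y]
      field_simp
      ring
    rw [this]
    positivity
  have := neg_le_of_abs_le hcs
  nlinarith [mul_le_mul_of_nonneg_right hcβ (sq_nonneg y)]

end MeanSystem

/-! ### Expectations along a trajectory -/

section Expectation

variable {Ω : Type*} [MeasurableSpace Ω] {ℙ : Measure Ω} [IsProbabilityMeasure ℙ]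

lemma integrable_comp_finite {T : Type*} [Fintype T] {X : Ω → T}
    (hX : ∀ τ, MeasurableSet {ω | X ω = τ}) (g : T → ℝ) :
    Integrable (fun ω => g (X ω)) ℙ ∧
      ∫ ω, g (X ω) ∂ℙ = ∑ τ, ℙ.real {ω | X ω = τ} * g τ := by
  classical
  have h : (fun ω => g (X ω)) =
      fun ω => ∑ τ, ({ω | X ω = τ}).indicator (fun _ => g τ) ω := by
    ext ω
    simp [Set.indicator_apply]
  have hi : ∀ τ, Integrable (({ω | X ω = τ}).indicator fun _ => g τ) ℙ := fun τ =>
    (integrable_const _).indicator (hX τ)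
  rw [h]
  refine ⟨integrable_finsetSum _ fun τ _ => hi τ, ?_⟩
  rw [integral_finsetSum _ fun τ _ => hi τ]
  exact Finset.sum_congr rfl fun τ _ => by rw [integral_indicator_const _ (hX τ), smul_eq_mul]

variable {𝒮 𝒜 : Type*} [Fintype 𝒮] [Fintype 𝒜]

/-- `Z` is a function of `S₀, …, S_n` and `A₀, …, A_{n-1}`, the history that precedes `A_n`. -/
def IsHistory {β : Type*} (n : ℕ) (Z : (ℕ → 𝒮) → (ℕ → 𝒜) → β) : Prop :=
  ∀ s s' a a', (∀ i ≤ n, s i = s' i) → (∀ i < n, a i = a' i) → Z s a = Z s' a'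

/-- A history together with `A_n`, `S_{n+1}` and `A_{n+1}`. -/
abbrev Path (𝒮 𝒜 : Type*) (n : ℕ) : Type _ :=
  ((Fin (n + 1) → 𝒮) × (Fin n → 𝒜)) × 𝒜 × 𝒮 × 𝒜

/-- The states of a finite path, continued by a constant. -/
def Path.states {n : ℕ} (τ : Path 𝒮 𝒜 n) (i : ℕ) : 𝒮 :=
  if h : i < n + 1 then τ.1.1 ⟨i, h⟩ else τ.2.2.1

/-- The actions of a finite path, continued by a constant. -/
def Path.actions {n : ℕ} (τ : Path 𝒮 𝒜 n) (i : ℕ) : 𝒜 :=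
  if h : i < n then τ.1.2 ⟨i, h⟩ else if i = n then τ.2.1 else τ.2.2.2

/-- The finite path of length `n` cut out of a trajectory. -/
def pathOf (n : ℕ) (S : ℕ → Ω → 𝒮) (A : ℕ → Ω → 𝒜) (ω : Ω) : Path 𝒮 𝒜 n :=
  ((fun i => S i ω, fun i => A i ω), A n ω, S (n + 1) ω, A (n + 1) ω)

/-- The probability of a history. -/
def histWeight (M : MDP 𝒮 𝒜) (π : Policy 𝒮 𝒜) {n : ℕ}
    (h : (Fin (n + 1) → 𝒮) × (Fin n → 𝒜)) : ℝ :=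
  M.p₀ (h.1 0) * (∏ i : Fin n, π.prob (h.1 i.castSucc) (h.2 i)) *
    ∏ i : Fin n, M.p (h.1 i.castSucc) (h.2 i) (h.1 i.succ)

variable {M : MDP 𝒮 𝒜} {π : Policy 𝒮 𝒜} {S : ℕ → Ω → 𝒮} {A : ℕ → Ω → 𝒜}

lemma pathOf_eq_iff {n : ℕ} {τ : Path 𝒮 𝒜 n} {ω : Ω} :
    pathOf n S A ω = τ ↔ ∀ i ≤ n + 1, S i ω = τ.states i ∧ A i ω = τ.actions i := by
  constructor
  · rintro rfl i hi
    rcases Nat.lt_or_ge i n with h | h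
    · simp [Path.states, Path.actions, pathOf, h, h.trans (Nat.lt_succ_self n)]
    rcases h.eq_or_lt with rfl | h
    · simp [Path.states, Path.actions, pathOf]
    · obtain rfl : i = n + 1 := by omega
      simp [Path.states, Path.actions, pathOf]
  · intro h
    refine Prod.ext (Prod.ext (funext fun i => ?_) (funext fun i => ?_))
      (Prod.ext ?_ (Prod.ext ?_ ?_))
    · have := (h i (by omega)).1
      simpa [Path.states, pathOf, i.2] using this
    · have := (h i (by omega)).2
      simpa [Path.actions, pathOf, i.2] using this
    · simpa [Path.actions, pathOf] using (h n (by omega)).2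
    · simpa [Path.states, pathOf] using (h (n + 1) le_rfl).1
    · simpa [Path.actions, pathOf] using (h (n + 1) le_rfl).2

variable (hSA : IsTrajectory M π ℙ S A)
include hSA

lemma IsTrajectory.measurableSet_pathOf {n : ℕ} (τ : Path 𝒮 𝒜 n) :
    MeasurableSet {ω | pathOf n S A ω = τ} := by
  simp only [pathOf_eq_iff, Set.ofPred_forall]
  exact MeasurableSet.iInter fun i => MeasurableSet.iInter fun _ =>
    (hSA.measurable_state i _).inter (hSA.measurable_action i _)

lemma IsTrajectory.real_pathOf {n : ℕ} (τ : Path 𝒮 𝒜 n) :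
    ℙ.real {ω | pathOf n S A ω = τ} =
      histWeight M π τ.1 * (π.prob (τ.1.1 (Fin.last n)) τ.2.1 *
        M.p (τ.1.1 (Fin.last n)) τ.2.1 τ.2.2.1 * π.prob τ.2.2.1 τ.2.2.2) := by
  simp only [pathOf_eq_iff]
  rw [hSA.law, Finset.prod_range_succ, Finset.prod_range_succ, Finset.prod_range_succ,
    Finset.prod_range, Finset.prod_range]
  have e0 : τ.states 0 = τ.1.1 0 := by simp [Path.states]
  have e1 : τ.states n = τ.1.1 (Fin.last n) := by simp [Path.states, Fin.last]
  have e2 : τ.states (n + 1) = τ.2.2.1 := by simp [Path.states]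
  have e3 : τ.actions n = τ.2.1 := by simp [Path.actions]
  have e4 : τ.actions (n + 1) = τ.2.2.2 := by simp [Path.actions]
  have e5 : ∀ i : Fin n, τ.states i = τ.1.1 i.castSucc := fun i => by
    simp [Path.states, Fin.castSucc, Fin.castAdd, Fin.castLE, Nat.lt_succ_of_lt i.2]
  have e6 : ∀ i : Fin n, τ.states (i + 1) = τ.1.1 i.succ := fun i => by
    simp [Path.states, Fin.succ]
  have e7 : ∀ i : Fin n, τ.actions i = τ.1.2 i := fun i => by simp [Path.actions]
  simp only [e0, e1, e2, e3, e4, e5, e6, e7, histWeight]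
  ring

omit [IsProbabilityMeasure ℙ] hSA in
lemma IsHistory.apply_pathOf {β : Type*} {n : ℕ} {Z : (ℕ → 𝒮) → (ℕ → 𝒜) → β}
    (hZ : IsHistory n Z) (ω : Ω) : Z (fun k => S k ω) (fun k => A k ω) =
      Z (pathOf n S A ω).states (pathOf n S A ω).actions := by
  have h := pathOf_eq_iff.1 (rfl : pathOf n S A ω = pathOf n S A ω)
  exact hZ _ _ _ _ (fun i hi => (h i (by omega)).1) fun i hi => (h i (by omega)).2

lemma IsTrajectory.integrable {n : ℕ} {F : (ℕ → 𝒮) → (ℕ → 𝒜) → ℝ} (hF : IsHistory n F) :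
    Integrable (fun ω => F (fun k => S k ω) fun k => A k ω) ℙ := by
  simp only [fun ω => hF.apply_pathOf (S := S) (A := A) ω]
  exact (integrable_comp_finite (fun τ => hSA.measurableSet_pathOf τ)
    fun τ => F τ.states τ.actions).1

/-- The Markov property: given `S₀, A₀, …, S_n`, the pair `(A_n, S_{n+1})` has the law
`π(a | S_n) p(s' | S_n, a)`. -/
lemma IsTrajectory.integral_step {n : ℕ} {F : (ℕ → 𝒮) → (ℕ → 𝒜) → 𝒜 → 𝒮 → ℝ}
    (hF : IsHistory n F) :
    ∫ ω, F (fun k => S k ω) (fun k => A k ω) (A n ω) (S (n + 1) ω) ∂ℙ =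
      ∫ ω, ∑ a, ∑ s', π.prob (S n ω) a * M.p (S n ω) a s' *
        F (fun k => S k ω) (fun k => A k ω) a s' ∂ℙ := by
  simp only [fun ω => hF.apply_pathOf (S := S) (A := A) ω]
  rw [show (∫ ω, F (pathOf n S A ω).states (pathOf n S A ω).actions (A n ω) (S (n + 1) ω) ∂ℙ) =
      ∑ τ : Path 𝒮 𝒜 n, ℙ.real {ω | pathOf n S A ω = τ} * F τ.states τ.actions τ.2.1 τ.2.2.1 from
    (integrable_comp_finite (fun τ => hSA.measurableSet_pathOf τ)
      fun τ : Path 𝒮 𝒜 n => F τ.states τ.actions τ.2.1 τ.2.2.1).2]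
  rw [show (∫ ω, ∑ a, ∑ s', π.prob (S n ω) a * M.p (S n ω) a s' *
        F (pathOf n S A ω).states (pathOf n S A ω).actions a s' ∂ℙ) =
      ∑ τ : Path 𝒮 𝒜 n, ℙ.real {ω | pathOf n S A ω = τ} *
        ∑ a, ∑ s', π.prob (τ.1.1 (Fin.last n)) a * M.p (τ.1.1 (Fin.last n)) a s' *
          F τ.states τ.actions a s' from
    (integrable_comp_finite (fun τ => hSA.measurableSet_pathOf τ)
      fun τ : Path 𝒮 𝒜 n => ∑ a, ∑ s', π.prob (τ.1.1 (Fin.last n)) a *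
        M.p (τ.1.1 (Fin.last n)) a s' * F τ.states τ.actions a s').2]
  simp only [hSA.real_pathOf]
  rw [Fintype.sum_prod_type (f := fun τ : Path 𝒮 𝒜 n => _),
    Fintype.sum_prod_type (f := fun τ : Path 𝒮 𝒜 n => _)]
  refine Finset.sum_congr rfl fun h _ => ?_
  -- On paths with the history `h`, `F` depends on the path only through `h`.
  have hFh : ∀ (y y' : 𝒜 × 𝒮 × 𝒜), F (Path.states (h, y)) (Path.actions (h, y)) =
      F (Path.states (h, y')) (Path.actions (h, y')) := fun y y' =>
    hF _ _ _ _ (fun i hi => by simp [Path.states, Nat.lt_succ_of_le hi])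
      fun i hi => by simp [Path.actions, hi]
  rcases isEmpty_or_nonempty (𝒜 × 𝒮 × 𝒜) with he | ⟨⟨y₀⟩⟩
  · simp
  simp only [fun y => hFh y y₀]
  set G := F (Path.states (h, y₀)) (Path.actions (h, y₀))
  set u := h.1 (Fin.last n)
  simp only [Fintype.sum_prod_type]
  have e1 : ∀ a s' (c : ℝ), ∑ a', histWeight M π h * (π.prob u a * M.p u a s' * π.prob s' a') * c =
      histWeight M π h * (π.prob u a * M.p u a s') * c := fun a s' c => by
    have : ∀ a', histWeight M π h * (π.prob u a * M.p u a s' * π.prob s' a') * c =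
      histWeight M π h * (π.prob u a * M.p u a s') * c * π.prob s' a' := fun a' => by ring
    simp only [this]
    rw [← Finset.mul_sum, π.prob_sum, mul_one]
  simp only [e1]
  have e2 : ∀ a, ∑ s', histWeight M π h * (π.prob u a * M.p u a s') =
      histWeight M π h * π.prob u a := fun a => by
    rw [← Finset.mul_sum, ← Finset.mul_sum, M.p_sum, mul_one]
  simp only [← Finset.sum_mul, e2]
  rw [← Finset.mul_sum, π.prob_sum, mul_one, Finset.mul_sum]
  refine Finset.sum_congr rfl fun a _ => ?_
  rw [Finset.mul_sum]
  exact Finset.sum_congr rfl fun s' _ => by ring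

end Expectation

/-! ### The average reward -/

section AverageReward

variable {Ω : Type*} [MeasurableSpace Ω] {ℙ : Measure Ω} [IsProbabilityMeasure ℙ]
  {𝒮 𝒜 : Type*} [Fintype 𝒮] [DecidableEq 𝒮] [Fintype 𝒜]
  {M : MDP 𝒮 𝒜} {π : Policy 𝒮 𝒜} {S : ℕ → Ω → 𝒮} {A : ℕ → Ω → 𝒜}

lemma sum_prob_mul_p (M : MDP 𝒮 𝒜) (π : Policy 𝒮 𝒜) (s : 𝒮) (g : 𝒮 → ℝ) :
    ∑ a, ∑ s', π.prob s a * M.p s a s' * g s' = (transMatrix M π *ᵥ g) s := by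
  rw [Finset.sum_comm]
  simp only [Matrix.mulVec, dotProduct, transMatrix, Matrix.of_apply, Finset.sum_mul]

lemma sum_prob_mul_p_action (M : MDP 𝒮 𝒜) (π : Policy 𝒮 𝒜) (s : 𝒮) (g : 𝒜 → ℝ) :
    ∑ a, ∑ s', π.prob s a * M.p s a s' * g a = ∑ a, π.prob s a * g a := by
  refine Finset.sum_congr rfl fun a _ => ?_
  rw [← Finset.sum_mul, ← Finset.mul_sum, M.p_sum, mul_one]

/-- The Poisson equation for the reward, from the surjectivity of `1 - P + 𝟏 d_πᵀ`. -/
lemma exists_poisson_reward (hirr : (transMatrix M π).IsIrreducible) :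
    ∃ g : 𝒮 → ℝ, ∀ s, rewardVec M π s - statReward M π = g s - (transMatrix M π *ᵥ g) s := by
  have hP := transMatrix_mem_rowStochastic M π
  have hμ := isStationary_stationaryDist M π
  set μ := stationaryDist (transMatrix M π)
  set U : (𝒮 → ℝ) →ₗ[ℝ] (𝒮 → ℝ) := LinearMap.id - (transMatrix M π).mulVecLin +
    (LinearMap.pi fun _ => ∑ s', μ s' • LinearMap.proj s')
  have hU : ∀ g s, U g s = g s - (transMatrix M π *ᵥ g) s + ∑ s', μ s' * g s' := fun g s => by
    simp [U]
  have hinj : Function.Injective U := (injective_iff_map_eq_zero U).2 fun g hg =>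
    eq_zero_of_poisson hP.2 hirr hμ fun s => by rw [← hU, hg, Pi.zero_apply]
  obtain ⟨g, hg⟩ := LinearMap.injective_iff_surjective.1 hinj
    fun s => rewardVec M π s - statReward M π
  have hgs : ∀ s, g s - (transMatrix M π *ᵥ g) s + ∑ s', μ s' * g s' =
      rewardVec M π s - statReward M π := fun s => by rw [← hU, hg]
  have h0 : ∑ s', μ s' * g s' = 0 := by
    have := Finset.sum_congr rfl fun s (_ : s ∈ Finset.univ) => congrArg (μ s * ·) (hgs s)
    simp only [mul_add, mul_sub, Finset.sum_add_distrib, Finset.sum_sub_distrib,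
      hμ.sum_mul_mulVec, ← Finset.sum_mul, hμ.sum_eq_one, sub_self, zero_add, one_mul] at this
    rw [this, statReward, sub_self]
  exact ⟨g, fun s => by rw [← hgs s, h0, add_zero]⟩

lemma tendsto_meanReward (hirr : (transMatrix M π).IsIrreducible)
    (hSA : IsTrajectory M π ℙ S A) :
    Tendsto (meanReward M ℙ S A) atTop (𝓝 (statReward M π)) := by
  obtain ⟨g, hg⟩ := exists_poisson_reward (M := M) (π := π) hirr
  have hgi : ∀ t, Integrable (fun ω => g (S t ω)) ℙ := fun t =>
    hSA.integrable (n := t) (F := fun s _ => g (s t)) fun s s' a a' h _ => by simp only [h t le_rfl]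
  have hri : ∀ t, Integrable (fun ω => M.r (S t ω) (A t ω)) ℙ := fun t =>
    hSA.integrable (n := t + 1) (F := fun s a => M.r (s t) (a t)) fun s s' a a' h h' => by
      simp only [h t (by omega), h' t (by omega)]
  have hr : ∀ t, ∫ ω, M.r (S t ω) (A t ω) ∂ℙ =
      statReward M π + (∫ ω, g (S t ω) ∂ℙ - ∫ ω, g (S (t + 1) ω) ∂ℙ) := fun t => by
    have e1 := hSA.integral_step (n := t) (F := fun s _ b _ => M.r (s t) b)
      fun s s' a a' h _ => by simp only [h t le_rfl]
    have e2 := hSA.integral_step (n := t) (F := fun _ _ _ s' => g s')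
      fun s s' a a' _ _ => rfl
    simp only [sum_prob_mul_p, sum_prob_mul_p_action] at e1 e2
    have hPi : Integrable (fun ω => (transMatrix M π *ᵥ g) (S t ω)) ℙ :=
      hSA.integrable (n := t) (F := fun s _ => (transMatrix M π *ᵥ g) (s t))
        fun s s' a a' h _ => by simp only [h t le_rfl]
    rw [e1, e2, ← integral_sub (hgi t) hPi]
    have : ∀ ω, ∑ a, π.prob (S t ω) a * M.r (S t ω) a =
        statReward M π + (g (S t ω) - (transMatrix M π *ᵥ g) (S t ω)) := fun ω => by
      rw [← hg, rewardVec, add_sub_cancel]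
    simp only [this]
    rw [integral_add (f := fun _ => statReward M π)
      (g := fun ω => g (S t ω) - (transMatrix M π *ᵥ g) (S t ω))
      (integrable_const _) ((hgi t).sub hPi)]
    simp
  have hmean : ∀ T : ℕ, 0 < T → meanReward M ℙ S A T = statReward M π +
      1 / (T : ℝ) * (∫ ω, g (S 0 ω) ∂ℙ - ∫ ω, g (S T ω) ∂ℙ) := fun T hT => by
    rw [meanReward, integral_finsetSum _ fun t _ => hri t]
    simp only [hr, Finset.sum_add_distrib, Finset.sum_const, Finset.card_range, nsmul_eq_mul]
    rw [Finset.sum_range_sub' fun t => ∫ ω, g (S t ω) ∂ℙ]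
    have : (T : ℝ) ≠ 0 := by positivity
    field_simp
  have hb : ∀ t, |∫ ω, g (S t ω) ∂ℙ| ≤ ‖g‖ := fun t => by
    have := norm_integral_le_of_norm_le_const (μ := ℙ) (f := fun ω => g (S t ω)) (C := ‖g‖)
      (Eventually.of_forall fun ω => norm_le_pi_norm g (S t ω))
    simpa using this
  have hlim : Tendsto (fun T : ℕ => 1 / (T : ℝ) * (∫ ω, g (S 0 ω) ∂ℙ - ∫ ω, g (S T ω) ∂ℙ))
      atTop (𝓝 0) := by
    refine squeeze_zero_norm (a := fun T : ℕ => 1 / (T : ℝ) * (2 * ‖g‖)) (fun T => ?_) ?_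
    · rw [norm_mul, Real.norm_of_nonneg (by positivity)]
      refine mul_le_mul_of_nonneg_left ?_ (by positivity)
      rw [Real.norm_eq_abs]
      linarith [abs_sub (∫ ω, g (S 0 ω) ∂ℙ) (∫ ω, g (S T ω) ∂ℙ), hb 0, hb T]
    · simpa using tendsto_one_div_atTop_nhds_zero_nat.mul_const (2 * ‖g‖)
  have := (tendsto_const_nhds (x := statReward M π)).add hlim
  rw [add_zero] at this
  refine this.congr' ?_
  filter_upwards [eventually_gt_atTop 0] with T hT using (hmean T hT).symm

end AverageReward

/-! ### The Poisson equation for the chain of states and traces -/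

section Corrector

variable {𝒮 𝒜 : Type*} [Fintype 𝒮] {d : ℕ}

/-- The functions `(s, e) ↦ φ(s) + ⟨ψ(s), e⟩` of a state and a trace, as pairs `(φ, ψ)`. -/
abbrev TraceFun (𝒮 : Type*) (d : ℕ) : Type _ :=
  (𝒮 → ℝ) × (𝒮 → EuclideanSpace ℝ (Fin d))

/-- The value at `(s, e)` of the function represented by a pair. -/
def TraceFun.eval (F : TraceFun 𝒮 d) (s : 𝒮) (e : EuclideanSpace ℝ (Fin d)) : ℝ :=
  F.1 s + inner ℝ (F.2 s) e

lemma TraceFun.abs_eval_le (F : TraceFun 𝒮 d) (s : 𝒮) (e : EuclideanSpace ℝ (Fin d)) :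
    |F.eval s e| ≤ ‖F‖ * (1 + ‖e‖) := by
  have h1 : |F.1 s| ≤ ‖F‖ := (norm_le_pi_norm F.1 s).trans (norm_fst_le F)
  have h2 : ‖F.2 s‖ ≤ ‖F‖ := (norm_le_pi_norm F.2 s).trans (norm_snd_le F)
  have h3 := abs_real_inner_le_norm (F.2 s) e
  have h4 := mul_le_mul_of_nonneg_right h2 (norm_nonneg e)
  calc |F.eval s e| ≤ |F.1 s| + |inner ℝ (F.2 s) e| := abs_add_le _ _
    _ ≤ ‖F‖ * (1 + ‖e‖) := by linarith

lemma TraceFun.eval_sub (F G : TraceFun 𝒮 d) (s : 𝒮) (e : EuclideanSpace ℝ (Fin d)) :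
    (F - G).eval s e = F.eval s e - G.eval s e := by
  simp only [TraceFun.eval, Prod.fst_sub, Prod.snd_sub, Pi.sub_apply, inner_sub_left]
  ring

variable [DecidableEq 𝒮] {P : Matrix 𝒮 𝒮 ℝ} {μ : 𝒮 → ℝ}

/-- A continuous linear solution operator of the Poisson equation on `TraceFun`. The pair
`(φ, ψ)` for the right-hand side `F` solves `ψ - λ P ψ = F.2` and
`φ - P (φ + ⟨ψ, x⟩) = F.1 - mean`. -/
lemma exists_poisson_operator (hP : P ∈ Matrix.rowStochastic ℝ 𝒮) (hirr : P.IsIrreducible)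
    (hμ : IsStationary P μ) {lam : ℝ} (h0 : 0 ≤ lam) (h1 : lam < 1)
    (x : 𝒮 → EuclideanSpace ℝ (Fin d)) :
    ∃ T : TraceFun 𝒮 d →L[ℝ] TraceFun 𝒮 d, ∀ F,
      (∀ s, (T F).2 s = F.2 s + lam • ∑ s', P s s' • (T F).2 s') ∧
      ∀ s e, ∑ s', P s s' * (T F).eval s' (lam • e + x s') =
        (T F).eval s e - F.eval s e +
          (∑ s', μ s' * F.1 s' + ∑ s', μ s' * inner ℝ ((T F).2 s') (x s')) := by
  set U : TraceFun 𝒮 d →ₗ[ℝ] TraceFun 𝒮 d :=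
    { toFun := fun F =>
        (fun s => F.1 s - ∑ s', P s s' * (F.1 s' + inner ℝ (F.2 s') (x s')) + ∑ s', μ s' * F.1 s',
          fun s => F.2 s - lam • ∑ s', P s s' • F.2 s')
      map_add' := fun F G => by
        ext s
        · simp only [Prod.fst_add, Prod.snd_add, Pi.add_apply, inner_add_left, mul_add,
            Finset.sum_add_distrib]
          ring
        · simp only [Prod.snd_add, Pi.add_apply, smul_add, Finset.sum_add_distrib,
            PiLp.add_apply, PiLp.sub_apply]
          ring
      map_smul' := fun c F => by
        ext s
        · simp only [Prod.smul_fst, Prod.smul_snd, Pi.smul_apply, real_inner_smul_left,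
            smul_eq_mul, RingHom.id_apply, mul_add, Finset.sum_add_distrib, mul_sub,
            Finset.mul_sum, mul_left_comm c]
        · simp only [Prod.smul_snd, Pi.smul_apply, RingHom.id_apply, smul_sub,
            Finset.smul_sum, smul_comm c] }
  have hU1 : ∀ F s, (U F).1 s =
    F.1 s - ∑ s', P s s' * (F.1 s' + inner ℝ (F.2 s') (x s')) + ∑ s', μ s' * F.1 s' :=
    fun F s => rfl
  have hU2 : ∀ F s, (U F).2 s = F.2 s - lam • ∑ s', P s s' • F.2 s' := fun F s => rfl
  have hinj : Function.Injective U := by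
    refine (injective_iff_map_eq_zero U).2 fun F hF => ?_
    have hψ : F.2 = 0 := eq_zero_of_eq_lam_average hP h0 h1 fun s => by
      have := hU2 F s
      rw [hF] at this
      exact (sub_eq_zero.1 this.symm)
    have hφ : F.1 = 0 := eq_zero_of_poisson hP.2 hirr hμ fun s => by
      have := hU1 F s
      rw [hF, hψ] at this
      simp only [Pi.zero_apply, inner_zero_left, add_zero, Prod.fst_zero] at this
      simpa [Matrix.mulVec, dotProduct] using this.symm
    exact Prod.ext hφ hψ
  set T := (LinearEquiv.ofInjectiveEndo U hinj).symm
  have hUT : ∀ F, U (T F) = F := fun F =>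
    (LinearEquiv.ofInjectiveEndo U hinj).apply_symm_apply F
  refine ⟨T.toLinearMap.toContinuousLinearMap, fun F => ?_⟩
  change (∀ s, (T F).2 s = F.2 s + lam • ∑ s', P s s' • (T F).2 s') ∧
      ∀ s e, ∑ s', P s s' * (T F).eval s' (lam • e + x s') =
        (T F).eval s e - F.eval s e +
          (∑ s', μ s' * F.1 s' + ∑ s', μ s' * inner ℝ ((T F).2 s') (x s'))
  have e1 : ∀ s, (T F).1 s - ∑ s', P s s' * ((T F).1 s' + inner ℝ ((T F).2 s') (x s')) +
      ∑ s', μ s' * (T F).1 s' = F.1 s := fun s => by rw [← hU1, hUT]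
  have e2 : ∀ s, (T F).2 s = F.2 s + lam • ∑ s', P s s' • (T F).2 s' := fun s => by
    rw [← sub_eq_iff_eq_add, ← hU2, hUT]
  refine ⟨e2, fun s e => ?_⟩
  -- Integrating the equation for `φ` against `μ` identifies its additive constant.
  have hm : ∑ s', μ s' * (T F).1 s' =
      ∑ s', μ s' * F.1 s' + ∑ s', μ s' * inner ℝ ((T F).2 s') (x s') := by
    have h := Finset.sum_congr rfl fun s (_ : s ∈ Finset.univ) => congrArg (μ s * ·) (e1 s)
    have h2 := hμ.sum_mul_mulVec fun s' => (T F).1 s' + inner ℝ ((T F).2 s') (x s')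
    simp only [Matrix.mulVec, dotProduct] at h2
    simp only [mul_add (μ _), mul_sub, Finset.sum_add_distrib, Finset.sum_sub_distrib,
      ← Finset.sum_mul, hμ.sum_eq_one, one_mul, h2] at h
    linarith
  have e3 : inner ℝ ((T F).2 s) e =
      inner ℝ (F.2 s) e + lam * ∑ s', P s s' * inner ℝ ((T F).2 s') e := by
    conv_lhs => rw [e2 s]
    simp only [inner_add_left, real_inner_smul_left, sum_inner]
  have e4 : ∑ s', P s s' * (T F).eval s' (lam • e + x s') =
      ∑ s', P s s' * ((T F).1 s' + inner ℝ ((T F).2 s') (x s')) +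
        lam * ∑ s', P s s' * inner ℝ ((T F).2 s') e := by
    rw [Finset.mul_sum, ← Finset.sum_add_distrib]
    refine Finset.sum_congr rfl fun s' _ => ?_
    simp only [TraceFun.eval, inner_add_right, real_inner_smul_right]
    ring
  rw [e4]
  simp only [TraceFun.eval]
  linarith [e1 s]

end Corrector

section Drift

variable {𝒮 𝒜 : Type*} [Fintype 𝒮] [DecidableEq 𝒮] [Fintype 𝒜] {d : ℕ}

/-- The conditional mean, given `S_t = s`, of the temporal-difference error of the iterate with
average-reward error `y` and weights `w`. -/
def meanTDError (M : MDP 𝒮 𝒜) (π : Policy 𝒮 𝒜) (x : 𝒮 → EuclideanSpace ℝ (Fin d))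
    (y : ℝ) (w : EuclideanSpace ℝ (Fin d)) (s : 𝒮) : ℝ :=
  rewardVec M π s - statReward M π - y +
    ((transMatrix M π *ᵥ fun s' => inner ℝ (x s') w) s - inner ℝ (x s) w)

/-- The rate of change of `½ (y² + ‖u‖²)` in state `s` with trace `e`, at the error `z = (y, u)` of
the weights `w₁ + u`, as a function of `(s, e)`. -/
def noiseFun (M : MDP 𝒮 𝒜) (π : Policy 𝒮 𝒜) (x : 𝒮 → EuclideanSpace ℝ (Fin d)) (cβ : ℝ)
    (w₁ : EuclideanSpace ℝ (Fin d)) (z : ℝ × EuclideanSpace ℝ (Fin d)) : TraceFun 𝒮 d :=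
  (fun s => cβ * z.1 * (rewardVec M π s - statReward M π - z.1),
    fun s => meanTDError M π x z.1 (w₁ + z.2) s • z.2)

variable {M : MDP 𝒮 𝒜} {π : Policy 𝒮 𝒜} {x : 𝒮 → EuclideanSpace ℝ (Fin d)} {lam : ℝ}

/-- `noiseFun` is a polynomial of degree two in `z` without constant term. -/
lemma exists_noiseFun_bounds (M : MDP 𝒮 𝒜) (π : Policy 𝒮 𝒜)
    (x : 𝒮 → EuclideanSpace ℝ (Fin d)) (cβ : ℝ) (w₁ : EuclideanSpace ℝ (Fin d)) :
    ∃ C : ℝ, 0 ≤ C ∧ (∀ z, ‖noiseFun M π x cβ w₁ z‖ ≤ C * (‖z‖ + ‖z‖ ^ 2)) ∧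
      ∀ z z', ‖noiseFun M π x cβ w₁ z' - noiseFun M π x cβ w₁ z‖ ≤
        C * (‖z' - z‖ * (1 + ‖z‖ + ‖z'‖)) := by
  set P := transMatrix M π
  set A₁ : ℝ × EuclideanSpace ℝ (Fin d) →ₗ[ℝ] TraceFun 𝒮 d :=
    { toFun := fun z => (fun s => cβ * z.1 * (rewardVec M π s - statReward M π),
        fun s => meanTDError M π x 0 w₁ s • z.2)
      map_add' := fun z z' => by
        ext s
        · simp only [Prod.fst_add, Pi.add_apply]
          ring
        · simp only [Prod.snd_add, Pi.add_apply, smul_add]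
      map_smul' := fun c z => by
        ext s
        · simp only [Prod.smul_fst, Pi.smul_apply, smul_eq_mul, RingHom.id_apply]
          ring
        · simp only [Prod.smul_snd, Pi.smul_apply, RingHom.id_apply, smul_comm c] }
  set A₂ : ℝ × EuclideanSpace ℝ (Fin d) →ₗ[ℝ]
      ℝ × EuclideanSpace ℝ (Fin d) →ₗ[ℝ] TraceFun 𝒮 d :=
    LinearMap.mk₂ ℝ (fun z z' => (fun _ => -cβ * z.1 * z'.1,
      fun s => (-z.1 + (∑ s', P s s' * inner ℝ (x s') z.2 - inner ℝ (x s) z.2)) • z'.2))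
      (fun z₁ z₂ z' => by
        ext s
        · simp only [Prod.fst_add, Pi.add_apply]
          ring
        · simp only [Prod.fst_add, Prod.snd_add, Pi.add_apply, inner_add_right, mul_add,
            Finset.sum_add_distrib, PiLp.add_apply, PiLp.smul_apply, smul_eq_mul]
          ring)
      (fun c z z' => by
        ext s
        · simp only [Prod.smul_fst, Pi.smul_apply, smul_eq_mul]
          ring
        · simp only [Prod.smul_fst, Prod.smul_snd, Pi.smul_apply, real_inner_smul_right,
            mul_left_comm _ c, ← Finset.mul_sum, PiLp.smul_apply, smul_eq_mul]
          ring)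
      (fun z z₁ z₂ => by
        ext s
        · simp only [Prod.fst_add, Pi.add_apply]
          ring
        · simp only [Prod.snd_add, Pi.add_apply, smul_add])
      (fun c z z' => by
        ext s
        · simp only [Prod.smul_fst, Pi.smul_apply, smul_eq_mul]
          ring
        · simp only [Prod.smul_snd, Pi.smul_apply, smul_comm c])
  set B₁ := A₁.toContinuousLinearMap
  set B₂ := A₂.toContinuousBilinearMap
  have hN : ∀ z, noiseFun M π x cβ w₁ z = B₁ z + B₂ z z := fun z => by
    change noiseFun M π x cβ w₁ z = A₁ z + A₂ z z
    ext s
    · simp only [noiseFun, A₁, A₂, LinearMap.mk₂_apply, LinearMap.coe_mk, AddHom.coe_mk,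
        Prod.fst_add, Pi.add_apply]
      ring
    · simp only [noiseFun, meanTDError, A₁, A₂, LinearMap.mk₂_apply, LinearMap.coe_mk,
        AddHom.coe_mk, Prod.snd_add, Pi.add_apply, ← add_smul, inner_add_right, Matrix.mulVec,
        dotProduct, mul_add, Finset.sum_add_distrib, P]
      simp only [PiLp.smul_apply, smul_eq_mul]
      ring
  refine ⟨‖B₁‖ + ‖B₂‖, by positivity, fun z => ?_, fun z z' => ?_⟩
  · rw [hN]
    have h1 := B₁.le_opNorm z
    have h2 := B₂.le_opNorm₂ z z
    have h3 := norm_add_le (B₁ z) (B₂ z z)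
    nlinarith [mul_nonneg (norm_nonneg B₁) (sq_nonneg ‖z‖),
      mul_nonneg (norm_nonneg B₂) (norm_nonneg z)]
  · have e : noiseFun M π x cβ w₁ z' - noiseFun M π x cβ w₁ z =
        B₁ (z' - z) + (B₂ (z' - z) z' + B₂ z (z' - z)) := by
      rw [hN, hN]
      simp only [map_sub, sub_apply]
      abel
    rw [e]
    have h1 := B₁.le_opNorm (z' - z)
    have h2 := B₂.le_opNorm₂ (z' - z) z'
    have h3 := B₂.le_opNorm₂ z (z' - z)
    have h4 := norm_add₃_le (a := B₁ (z' - z)) (b := B₂ (z' - z) z') (c := B₂ z (z' - z))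
    rw [add_assoc] at h4
    have p1 : 0 ≤ ‖B₁‖ * (‖z' - z‖ * (‖z‖ + ‖z'‖)) := by positivity
    have p2 : 0 ≤ ‖B₂‖ * ‖z' - z‖ := by positivity
    nlinarith

/-- The stationary mean of `noiseFun` is the quadratic form of the augmented matrix; the terms of
first order in `u` cancel because `w₁` solves `A̅ w + b̅ = 0`. -/
lemma noiseFun_mean (h0 : 0 ≤ lam) (h1 : lam < 1)
    {cβ : ℝ} {w₁ : EuclideanSpace ℝ (Fin d)} (hw₁ : w₁ ∈ Wstar M π x lam (statReward M π))
    {y : ℝ} {u : EuclideanSpace ℝ (Fin d)} (hu : u ∈ (constKer x)ᗮ)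
    {ψ : 𝒮 → EuclideanSpace ℝ (Fin d)}
    (hψ : ∀ s, ψ s = (noiseFun M π x cβ w₁ (y, u)).2 s +
      lam • ∑ s', transMatrix M π s s' • ψ s') :
    ∑ s, stationaryDist (transMatrix M π) s * (noiseFun M π x cβ w₁ (y, u)).1 s +
      ∑ s, stationaryDist (transMatrix M π) s * inner ℝ (ψ s) (x s) =
        augForm M π x lam cβ y u := by
  have hP := transMatrix_mem_rowStochastic M π
  have hμ := isStationary_stationaryDist M π
  set P := transMatrix M π with hPdef
  set μ := stationaryDist P
  set f := meanTDError M π x y (w₁ + u)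
  set X : EuclideanSpace ℝ (Fin d) → 𝒮 → ℝ := fun w s => inner ℝ (x s) w
  -- The solution `ψ` is unique, so it is the discounted sum of `f` times `u`.
  have hψΓ : ∀ s, ψ s = rewardVecLam P f lam s • u := by
    have : (fun s => ψ s - rewardVecLam P f lam s • u) = 0 :=
      eq_zero_of_eq_lam_average hP h0 h1 fun s => by
        rw [hψ s, rewardVecLam_eq hP h0 h1 f s]
        simp only [smul_sub, Finset.sum_sub_distrib, smul_smul, ← Finset.sum_smul, add_smul,
          noiseFun, f]
        abel
    exact fun s => sub_eq_zero.1 (congrFun this s)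
  have hf : f = (rewardVec M π + (-(statReward M π + y)) • (1 : 𝒮 → ℝ)) +
      (1 : ℝ) • (P *ᵥ X (w₁ + u) - X (w₁ + u)) := by
    ext s
    simp only [f, meanTDError, Pi.add_apply, Pi.smul_apply, Pi.sub_apply, Pi.one_apply,
      smul_eq_mul, X, P]
    ring
  have hX : X (w₁ + u) = X w₁ + X u := by
    ext s
    simp only [X, inner_add_right, Pi.add_apply]
  have hΓ : ∀ s, rewardVecLam P f lam s =
      ((transMatrixLam P lam *ᵥ X w₁) s - X w₁ s) +
        (rewardVecLam P (rewardVec M π) lam s - statReward M π / (1 - lam)) +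
        (((transMatrixLam P lam *ᵥ X u) s - X u s) - y * (1 - lam)⁻¹) := fun s => by
    rw [hf, rewardVecLam_add_smul hP h0 h1, rewardVecLam_add_smul hP h0 h1,
      rewardVecLam_one hP h0 h1, rewardVecLam_mulVec_sub hP h0 h1, hX, Matrix.mulVec_add]
    simp only [Pi.add_apply]
    ring
  have hW := mem_Wstar_iff.1 hw₁ u
  have hA := inner_Abar (M := M) (π := π) (x := x) (lam := lam) u u
  have hq := inner_traceMean (M := M) (π := π) (x := x) h0 h1 u
  have e1 : ∑ s, μ s * (noiseFun M π x cβ w₁ (y, u)).1 s = -cβ * y ^ 2 := by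
    have : ∀ s, μ s * (noiseFun M π x cβ w₁ (y, u)).1 s =
        cβ * y * (μ s * rewardVec M π s - μ s * (statReward M π + y)) := fun s => by
      simp only [noiseFun]
      ring
    simp only [this]
    rw [← Finset.mul_sum, Finset.sum_sub_distrib, ← Finset.sum_mul, hμ.sum_eq_one]
    change cβ * y * (statReward M π - 1 * (statReward M π + y)) = _
    ring
  have e2 : ∑ s, μ s * inner ℝ (ψ s) (x s) =
      (∑ s, μ s * X u s * ((transMatrixLam P lam *ᵥ X w₁) s - X w₁ s) +
        ∑ s, μ s * X u s *
          (rewardVecLam P (rewardVec M π) lam s - statReward M π / (1 - lam))) +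
      (∑ s, μ s * X u s * ((transMatrixLam P lam *ᵥ X u) s - X u s) -
        y * ((1 - lam)⁻¹ * ∑ s, μ s * X u s)) := by
    simp only [Finset.mul_sum, ← Finset.sum_add_distrib, ← Finset.sum_sub_distrib]
    refine Finset.sum_congr rfl fun s _ => ?_
    rw [hψΓ, hΓ, real_inner_smul_left, real_inner_comm]
    change _ * (_ * X u s) = _
    ring
  rw [e1, e2, augForm_eq hu, hA, hq]
  change -cβ * y ^ 2 + (_ + _) = _
  rw [show ∑ s, μ s * X u s * ((transMatrixLam P lam *ᵥ X w₁) s - X w₁ s) +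
        ∑ s, μ s * X u s *
          (rewardVecLam P (rewardVec M π) lam s - statReward M π / (1 - lam)) = 0 from hW, zero_add]

/-- The corrector `G`: a solution of the Poisson equation whose right-hand side is the rate of
change of `½ (y² + ‖u‖²)` minus its stationary mean, with quadratic growth in `z`. -/
lemma exists_corrector (hirr : (transMatrix M π).IsIrreducible) (h0 : 0 ≤ lam) (h1 : lam < 1)
    (cβ : ℝ) {w₁ : EuclideanSpace ℝ (Fin d)} (hw₁ : w₁ ∈ Wstar M π x lam (statReward M π)) :
    ∃ (G : 𝒮 → EuclideanSpace ℝ (Fin d) → ℝ × EuclideanSpace ℝ (Fin d) → ℝ) (C : ℝ), 0 ≤ C ∧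
      (∀ s e y, ∀ u ∈ (constKer x)ᗮ,
        ∑ s', transMatrix M π s s' * G s' (lam • e + x s') (y, u) =
          G s e (y, u) - (noiseFun M π x cβ w₁ (y, u)).eval s e + augForm M π x lam cβ y u) ∧
      (∀ s e z, |G s e z| ≤ C * (1 + ‖e‖) * (‖z‖ + ‖z‖ ^ 2)) ∧
      ∀ s e z z', |G s e z' - G s e z| ≤ C * (1 + ‖e‖) * (‖z' - z‖ * (1 + ‖z‖ + ‖z'‖)) := by
  obtain ⟨T, hT⟩ := exists_poisson_operator (transMatrix_mem_rowStochastic M π) hirr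
    (isStationary_stationaryDist M π) h0 h1 x
  obtain ⟨C, hC, hb, hl⟩ := exists_noiseFun_bounds M π x cβ w₁
  refine ⟨fun s e z => (T (noiseFun M π x cβ w₁ z)).eval s e, ‖T‖ * C, by positivity,
    fun s e y u hu => ?_, fun s e z => ?_, fun s e z z' => ?_⟩
  · rw [(hT _).2, noiseFun_mean h0 h1 hw₁ hu (hT _).1]
  · refine (TraceFun.abs_eval_le _ s e).trans ?_
    have := (T.le_opNorm (noiseFun M π x cβ w₁ z)).trans
      (mul_le_mul_of_nonneg_left (hb z) (norm_nonneg T))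
    calc _ ≤ ‖T‖ * (C * (‖z‖ + ‖z‖ ^ 2)) * (1 + ‖e‖) :=
          mul_le_mul_of_nonneg_right this (by positivity)
      _ = _ := by ring
  · rw [← TraceFun.eval_sub, ← map_sub]
    refine (TraceFun.abs_eval_le _ s e).trans ?_
    have := (T.le_opNorm (noiseFun M π x cβ w₁ z' - noiseFun M π x cβ w₁ z)).trans
      (mul_le_mul_of_nonneg_left (hl z z') (norm_nonneg T))
    calc _ ≤ ‖T‖ * (C * (‖z' - z‖ * (1 + ‖z‖ + ‖z'‖))) * (1 + ‖e‖) :=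
          mul_le_mul_of_nonneg_right this (by positivity)
      _ = _ := by ring

end Drift

/-! ### A Lyapunov function for the error -/

section Lyapunov

variable {𝒮 𝒜 : Type*} [Fintype 𝒮] [DecidableEq 𝒮] [Fintype 𝒜] {d : ℕ}

/-- The squared Euclidean size `y² + ‖u‖²` of an error `z = (y, u)`. The norm `‖z‖` is the maximum
norm of the product. -/
def sqSize (z : ℝ × EuclideanSpace ℝ (Fin d)) : ℝ := z.1 ^ 2 + ‖z.2‖ ^ 2

lemma norm_sq_le_sqSize (z : ℝ × EuclideanSpace ℝ (Fin d)) : ‖z‖ ^ 2 ≤ sqSize z := by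
  rw [Prod.norm_def, sqSize, ← sq_abs z.1, ← Real.norm_eq_abs]
  rcases max_cases ‖z.1‖ ‖z.2‖ with h | h <;> rw [h.1] <;>
    nlinarith [sq_nonneg ‖z.1‖, sq_nonneg ‖z.2‖]

lemma sqSize_le (z : ℝ × EuclideanSpace ℝ (Fin d)) : sqSize z ≤ 2 * ‖z‖ ^ 2 := by
  have h1 : z.1 ^ 2 ≤ ‖z‖ ^ 2 := by
    rw [← sq_abs]
    exact pow_le_pow_left₀ (abs_nonneg _) (norm_fst_le z) 2
  have h2 : ‖z.2‖ ^ 2 ≤ ‖z‖ ^ 2 := pow_le_pow_left₀ (norm_nonneg _) (norm_snd_le z) 2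
  rw [sqSize]
  linarith

lemma sqSize_add_smul (z Δ : ℝ × EuclideanSpace ℝ (Fin d)) (a : ℝ) :
    sqSize (z + a • Δ) = sqSize z + 2 * a * (z.1 * Δ.1 + inner ℝ z.2 Δ.2) + a ^ 2 * sqSize Δ := by
  simp only [sqSize, Prod.fst_add, Prod.snd_add, Prod.smul_fst, Prod.smul_snd, smul_eq_mul]
  rw [norm_add_sq_real, real_inner_smul_right, norm_smul, mul_pow, Real.norm_eq_abs, sq_abs]
  ring

/-- The increment, per unit of step size, of the error `z = (y, u)` when the chain moves from `s`
to `s'` under the action `a` and the trace is `e`. -/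
def increment (M : MDP 𝒮 𝒜) (π : Policy 𝒮 𝒜) (x : 𝒮 → EuclideanSpace ℝ (Fin d)) (cβ : ℝ)
    (w₁ : EuclideanSpace ℝ (Fin d)) (s : 𝒮) (a : 𝒜) (s' : 𝒮) (e : EuclideanSpace ℝ (Fin d))
    (z : ℝ × EuclideanSpace ℝ (Fin d)) : ℝ × EuclideanSpace ℝ (Fin d) :=
  (cβ * (M.r s a - statReward M π - z.1),
    (M.r s a - statReward M π - z.1 + inner ℝ (x s' - x s) (w₁ + z.2)) •
      (constKer x)ᗮ.starProjection e)

variable {M : MDP 𝒮 𝒜} {π : Policy 𝒮 𝒜} {x : 𝒮 → EuclideanSpace ℝ (Fin d)} {lam : ℝ}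

lemma increment_mean {cβ : ℝ} {w₁ : EuclideanSpace ℝ (Fin d)} (s : 𝒮)
    (e : EuclideanSpace ℝ (Fin d)) (y : ℝ) {u : EuclideanSpace ℝ (Fin d)}
    (hu : u ∈ (constKer x)ᗮ) :
    ∑ a, ∑ s', π.prob s a * M.p s a s' *
      (y * (increment M π x cβ w₁ s a s' e (y, u)).1 +
        inner ℝ u (increment M π x cβ w₁ s a s' e (y, u)).2) =
      (noiseFun M π x cβ w₁ (y, u)).eval s e := by
  have hue : inner ℝ u ((constKer x)ᗮ.starProjection e) = inner ℝ u e := by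
    rw [← Submodule.inner_starProjection_left_eq_right, Submodule.starProjection_eq_self_iff.2 hu]
  have key : ∀ a s', π.prob s a * M.p s a s' *
      (y * (increment M π x cβ w₁ s a s' e (y, u)).1 +
        inner ℝ u (increment M π x cβ w₁ s a s' e (y, u)).2) =
      (cβ * y + inner ℝ u e) * (π.prob s a * M.p s a s' * M.r s a) +
      inner ℝ u e * (π.prob s a * M.p s a s' * inner ℝ (x s') (w₁ + u)) +
      (-(cβ * y + inner ℝ u e) * (statReward M π + y) - inner ℝ u e * inner ℝ (x s) (w₁ + u)) *
        (π.prob s a * M.p s a s' * 1) := fun a s' => by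
    simp only [increment, real_inner_smul_right, hue, inner_sub_left]
    ring
  simp only [key, Finset.sum_add_distrib, ← Finset.mul_sum]
  rw [sum_prob_mul_p_action M π s (fun a => M.r s a),
    sum_prob_mul_p M π s (fun s' => inner ℝ (x s') (w₁ + u)),
    sum_prob_mul_p_action M π s (fun _ => 1)]
  simp only [mul_one, π.prob_sum, TraceFun.eval, noiseFun, meanTDError, real_inner_smul_left,
    rewardVec]
  ring

lemma exists_increment_bound (M : MDP 𝒮 𝒜) (π : Policy 𝒮 𝒜)
    (x : 𝒮 → EuclideanSpace ℝ (Fin d)) (cβ : ℝ) (w₁ : EuclideanSpace ℝ (Fin d)) {E₀ : ℝ}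
    (hE₀ : 0 ≤ E₀) :
    ∃ D : ℝ, 0 ≤ D ∧ ∀ s a s' e z, ‖e‖ ≤ E₀ →
      ‖increment M π x cβ w₁ s a s' e z‖ ≤ D * (1 + ‖z‖) := by
  set R := ‖fun p : 𝒮 × 𝒜 => M.r p.1 p.2 - statReward M π‖
  have hR : ∀ s a, |M.r s a - statReward M π| ≤ R := fun s a =>
    norm_le_pi_norm (fun p : 𝒮 × 𝒜 => M.r p.1 p.2 - statReward M π) (s, a)
  have hR0 : 0 ≤ R := norm_nonneg _
  refine ⟨|cβ| * (R + 1) + (R + 1 + 2 * ‖x‖ * (‖w₁‖ + 1)) * E₀, by positivity,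
    fun s a s' e z he => ?_⟩
  have hz := norm_nonneg z
  have h1 : |M.r s a - statReward M π - z.1| ≤ (R + 1) * (1 + ‖z‖) := by
    have := abs_sub (M.r s a - statReward M π) z.1
    have hz1 : |z.1| ≤ ‖z‖ := norm_fst_le z
    nlinarith [hR s a, mul_nonneg hR0 hz]
  have h2 : |inner ℝ (x s' - x s) (w₁ + z.2)| ≤ 2 * ‖x‖ * (‖w₁‖ + 1) * (1 + ‖z‖) := by
    have a1 : ‖x s' - x s‖ ≤ 2 * ‖x‖ := by
      have := norm_sub_le (x s') (x s)
      linarith [norm_le_pi_norm x s, norm_le_pi_norm x s']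
    have a2 : ‖w₁ + z.2‖ ≤ (‖w₁‖ + 1) * (1 + ‖z‖) := by
      have := norm_add_le w₁ z.2
      nlinarith [norm_snd_le z, mul_nonneg (norm_nonneg w₁) hz]
    calc _ ≤ ‖x s' - x s‖ * ‖w₁ + z.2‖ := abs_real_inner_le_norm _ _
      _ ≤ 2 * ‖x‖ * ((‖w₁‖ + 1) * (1 + ‖z‖)) :=
          mul_le_mul a1 a2 (norm_nonneg _) (by positivity)
      _ = _ := by ring
  have h3 : ‖(constKer x)ᗮ.starProjection e‖ ≤ E₀ :=
    (Submodule.norm_starProjection_apply_le _ e).trans he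
  refine norm_prod_le_iff.2 ⟨?_, ?_⟩
  · calc _ = |cβ| * |M.r s a - statReward M π - z.1| := by
          rw [increment, Real.norm_eq_abs, abs_mul]
      _ ≤ |cβ| * ((R + 1) * (1 + ‖z‖)) := mul_le_mul_of_nonneg_left h1 (abs_nonneg _)
      _ = |cβ| * (R + 1) * (1 + ‖z‖) := by ring
      _ ≤ _ := mul_le_mul_of_nonneg_right (le_add_of_nonneg_right (by positivity)) (by positivity)
  · calc _ = |M.r s a - statReward M π - z.1 + inner ℝ (x s' - x s) (w₁ + z.2)| *
          ‖(constKer x)ᗮ.starProjection e‖ := by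
          rw [increment, norm_smul, Real.norm_eq_abs]
      _ ≤ ((R + 1) * (1 + ‖z‖) + 2 * ‖x‖ * (‖w₁‖ + 1) * (1 + ‖z‖)) * E₀ :=
          mul_le_mul ((abs_add_le _ _).trans (add_le_add h1 h2)) h3 (norm_nonneg _) (by positivity)
      _ = (R + 1 + 2 * ‖x‖ * (‖w₁‖ + 1)) * E₀ * (1 + ‖z‖) := by ring
      _ ≤ _ := mul_le_mul_of_nonneg_right (le_add_of_nonneg_left (by positivity)) (by positivity)

/-- One step of size `a`, before averaging, with `g = G s' e'` taken at the new state and trace: to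
first order in `a`, `g` may be evaluated at the old error `z` and multiplied by the old step
size. -/
lemma lyapunov_step_le {g : ℝ × EuclideanSpace ℝ (Fin d) → ℝ} {C D : ℝ} (hC : 0 ≤ C)
    (hD : 0 ≤ D) (hb : ∀ z, |g z| ≤ C * (‖z‖ + ‖z‖ ^ 2))
    (hl : ∀ z z', |g z' - g z| ≤ C * (‖z' - z‖ * (1 + ‖z‖ + ‖z'‖)))
    {a b : ℝ} (ha1 : a ≤ 1) (hb0 : 0 ≤ b) (hba : b ≤ a) (hab : a - b ≤ a ^ 2)
    {z Δ : ℝ × EuclideanSpace ℝ (Fin d)} (hΔ : ‖Δ‖ ≤ D * (1 + ‖z‖)) :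
    sqSize (z + a • Δ) + 2 * b * g (z + a • Δ) ≤
      sqSize z + 2 * a * (z.1 * Δ.1 + inner ℝ z.2 Δ.2) + 2 * a * g z +
        4 * (D ^ 2 + C * D * (2 + D) + C * (1 + D) ^ 2) * a ^ 2 * (1 + sqSize z) := by
  have ha0 : 0 ≤ a := hb0.trans hba
  set m := 1 + ‖z‖ with hm
  have hz := norm_nonneg z
  have hm1 : 1 ≤ m := by linarith
  have hm2 : m ^ 2 ≤ 2 * (1 + sqSize z) := by
    have := norm_sq_le_sqSize z
    nlinarith [sq_nonneg (‖z‖ - 1)]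
  set z' := z + a • Δ
  have hd : ‖z' - z‖ ≤ a * (D * m) := by
    have : z' - z = a • Δ := by simp [z']
    rw [this, norm_smul, Real.norm_of_nonneg ha0]
    exact mul_le_mul_of_nonneg_left hΔ ha0
  have hz' : 1 + ‖z'‖ ≤ (1 + D) * m := by
    have h1 : ‖z'‖ ≤ ‖z‖ + ‖z' - z‖ := by
      simpa using norm_add_le z (z' - z)
    have h2 : a * (D * m) ≤ 1 * (D * m) := mul_le_mul_of_nonneg_right ha1 (by positivity)
    linarith
  have h1 : sqSize Δ ≤ 2 * D ^ 2 * m ^ 2 := by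
    refine (sqSize_le Δ).trans ?_
    have := pow_le_pow_left₀ (norm_nonneg Δ) hΔ 2
    rw [mul_pow] at this
    linarith
  have h2 : g z' - g z ≤ a * (C * D * (2 + D) * m ^ 2) := by
    calc g z' - g z ≤ C * (‖z' - z‖ * (1 + ‖z‖ + ‖z'‖)) := (le_abs_self _).trans (hl z z')
      _ ≤ C * (a * (D * m) * ((2 + D) * m)) := by
          refine mul_le_mul_of_nonneg_left ?_ hC
          exact mul_le_mul hd (by linarith) (by positivity) (by positivity)
      _ = _ := by ring
  have h3 : -g z' ≤ C * (1 + D) ^ 2 * m ^ 2 := by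
    calc -g z' ≤ C * (‖z'‖ + ‖z'‖ ^ 2) := (neg_le_abs _).trans (hb z')
      _ ≤ C * (1 + ‖z'‖) ^ 2 := by
          refine mul_le_mul_of_nonneg_left ?_ hC
          nlinarith [norm_nonneg z']
      _ ≤ C * ((1 + D) * m) ^ 2 :=
          mul_le_mul_of_nonneg_left (pow_le_pow_left₀ (by positivity) hz' 2) hC
      _ = _ := by ring
  have e : 2 * b * g z' = 2 * a * g z + 2 * a * (g z' - g z) + 2 * (a - b) * (-g z') := by ring
  have h4 : 2 * a * (g z' - g z) ≤ 2 * a * (a * (C * D * (2 + D) * m ^ 2)) :=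
    mul_le_mul_of_nonneg_left h2 (by positivity)
  have h5 : 2 * (a - b) * (-g z') ≤ 2 * a ^ 2 * (C * (1 + D) ^ 2 * m ^ 2) :=
    (mul_le_mul_of_nonneg_left h3 (by linarith)).trans
      (mul_le_mul_of_nonneg_right (by linarith) (by positivity))
  have h6 : a ^ 2 * sqSize Δ ≤ a ^ 2 * (2 * D ^ 2 * m ^ 2) :=
    mul_le_mul_of_nonneg_left h1 (by positivity)
  have h7 : 2 * (D ^ 2 + C * D * (2 + D) + C * (1 + D) ^ 2) * a ^ 2 * m ^ 2 ≤
      2 * (D ^ 2 + C * D * (2 + D) + C * (1 + D) ^ 2) * a ^ 2 * (2 * (1 + sqSize z)) :=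
    mul_le_mul_of_nonneg_left hm2 (by positivity)
  rw [sqSize_add_smul, e]
  linarith

/-- A Lyapunov function `V a s e z`, equal to `sqSize z` up to `O(a)`, that contracts in the mean by
`1 - c a` in a step of size `a`, up to `O(a²)`. The next step size is `b`. -/
lemma exists_lyapunov (hirr : (transMatrix M π).IsIrreducible) (h0 : 0 ≤ lam) (h1 : lam < 1)
    {cβ c : ℝ} (hc : 0 < c) (hneg : AugNegDef M π x lam cβ c) {w₁ : EuclideanSpace ℝ (Fin d)}
    (hw₁ : w₁ ∈ Wstar M π x lam (statReward M π)) {E₀ : ℝ} (hE₀ : 0 ≤ E₀)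
    (hx : ∀ e s, ‖e‖ ≤ E₀ → ‖lam • e + x s‖ ≤ E₀) :
    ∃ (V : ℝ → 𝒮 → EuclideanSpace ℝ (Fin d) → ℝ × EuclideanSpace ℝ (Fin d) → ℝ) (K a₀ : ℝ),
      0 < K ∧ 0 < a₀ ∧ ∀ a b : ℝ, 0 ≤ b → b ≤ a → a ≤ a₀ → a - b ≤ a ^ 2 →
      ∀ s e z, ‖e‖ ≤ E₀ → z.2 ∈ (constKer x)ᗮ →
        ∑ i, ∑ s', π.prob s i * M.p s i s' *
          V b s' (lam • e + x s') (z + a • increment M π x cβ w₁ s i s' e z) ≤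
            (1 - c * a) * V a s e z + K * a ^ 2 ∧
        sqSize z ≤ 2 * V a s e z + K * a ^ 2 ∧ V a s e z ≤ K * (1 + sqSize z) := by
  obtain ⟨G, C', hC', hG, hGb, hGl⟩ := exists_corrector hirr h0 h1 cβ hw₁
  obtain ⟨D, hD, hDb⟩ := exists_increment_bound M π x cβ w₁ hE₀
  set C := C' * (1 + E₀) with hCdef
  have hC : 0 ≤ C := by positivity
  have hgb : ∀ s e, ‖e‖ ≤ E₀ → ∀ z, |G s e z| ≤ C * (‖z‖ + ‖z‖ ^ 2) := fun s e he z =>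
    (hGb s e z).trans (mul_le_mul_of_nonneg_right
      (mul_le_mul_of_nonneg_left (by linarith) hC') (by positivity))
  have hgl : ∀ s e, ‖e‖ ≤ E₀ → ∀ z z',
      |G s e z' - G s e z| ≤ C * (‖z' - z‖ * (1 + ‖z‖ + ‖z'‖)) := fun s e he z z' =>
    (hGl s e z z').trans (mul_le_mul_of_nonneg_right
      (mul_le_mul_of_nonneg_left (by linarith) hC') (by positivity))
  set K₀ := 4 * (D ^ 2 + C * D * (2 + D) + C * (1 + D) ^ 2) with hK₀
  have hK₀0 : 0 ≤ K₀ := by positivity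
  set K₁ := K₀ + 4 * c * C with hK₁
  have hK₁0 : 0 ≤ K₁ := by positivity
  refine ⟨fun a s e z => sqSize z + 2 * a * G s e z, K₁ + 8 * C ^ 2 + 4 * C + 1,
    min 1 (min (c / (K₁ + 1)) (1 / (8 * C + 1))), by positivity, by positivity, ?_⟩
  intro a b hb0 hba ha hab s e z he hz
  have ha0 : 0 ≤ a := hb0.trans hba
  have ha1 : a ≤ 1 := ha.trans (min_le_left _ _)
  have ha2 : K₁ * a ≤ c := by
    have : a ≤ c / (K₁ + 1) := ha.trans ((min_le_right _ _).trans (min_le_left _ _))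
    rw [le_div_iff₀ (by positivity)] at this
    linarith
  have ha3 : 8 * C * a ≤ 1 := by
    have : a ≤ 1 / (8 * C + 1) := ha.trans ((min_le_right _ _).trans (min_le_right _ _))
    rw [le_div_iff₀ (by positivity)] at this
    linarith
  have hN := norm_sq_le_sqSize z
  have hN0 : 0 ≤ sqSize z := (sq_nonneg _).trans hN
  have hGz := hgb s e he z
  have hsz : ‖z‖ + ‖z‖ ^ 2 ≤ 2 * (1 + sqSize z) := by nlinarith [sq_nonneg (‖z‖ - 1)]
  have hGz2 : |G s e z| ≤ C * (2 * (1 + sqSize z)) :=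
    hGz.trans (mul_le_mul_of_nonneg_left hsz hC)
  refine ⟨?_, ?_, ?_⟩
  · -- Average the one-step bound over the action and the next state.
    have hstep : ∀ i s', π.prob s i * M.p s i s' *
        (sqSize (z + a • increment M π x cβ w₁ s i s' e z) +
          2 * b * G s' (lam • e + x s') (z + a • increment M π x cβ w₁ s i s' e z)) ≤
        2 * a * (π.prob s i * M.p s i s' * (z.1 * (increment M π x cβ w₁ s i s' e z).1 +
          inner ℝ z.2 (increment M π x cβ w₁ s i s' e z).2)) +
        2 * a * (π.prob s i * M.p s i s' * G s' (lam • e + x s') z) +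
        (sqSize z + K₀ * a ^ 2 * (1 + sqSize z)) * (π.prob s i * M.p s i s' * 1) :=
      fun i s' => by
        have := mul_le_mul_of_nonneg_left
          (lyapunov_step_le hC hD (hgb s' _ (hx e s' he)) (hgl s' _ (hx e s' he)) ha1 hb0 hba hab
            (hDb s i s' e z he))
          (mul_nonneg (π.prob_nonneg s i) (M.p_nonneg s i s'))
        rw [← hK₀] at this
        refine this.trans (le_of_eq ?_)
        ring
    refine (Finset.sum_le_sum fun i _ => Finset.sum_le_sum fun s' _ => hstep i s').trans ?_
    simp only [Finset.sum_add_distrib, ← Finset.mul_sum]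
    obtain ⟨y, u⟩ := z
    rw [increment_mean s e y hz, sum_prob_mul_p M π s (fun s' => G s' (lam • e + x s') (y, u)),
      sum_prob_mul_p_action M π s (fun _ => 1)]
    simp only [Matrix.mulVec, dotProduct, mul_one, π.prob_sum]
    rw [hG s e y u hz]
    have hn := hneg y u hz
    change _ ≤ -c * sqSize (y, u) at hn
    have h2 : 2 * a * augForm M π x lam cβ y u ≤ 2 * a * (-c * sqSize (y, u)) :=
      mul_le_mul_of_nonneg_left hn (by positivity)
    have h3 : 2 * c * a ^ 2 * G s e (y, u) ≤ 2 * c * a ^ 2 * (C * (2 * (1 + sqSize (y, u)))) :=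
      mul_le_mul_of_nonneg_left ((le_abs_self _).trans hGz2) (by positivity)
    have h4 : K₁ * a * (a * sqSize (y, u)) ≤ c * (a * sqSize (y, u)) :=
      mul_le_mul_of_nonneg_right ha2 (by positivity)
    have h5 : 0 ≤ (8 * C ^ 2 + 4 * C + 1) * a ^ 2 := by positivity
    rw [hK₁] at h4 ⊢
    nlinarith
  · have h2 : -(2 * a * G s e z) ≤ 2 * a * (C * (‖z‖ + ‖z‖ ^ 2)) := by
      have := mul_le_mul_of_nonneg_left ((neg_le_abs _).trans hGz) (by positivity : 0 ≤ 2 * a)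
      linarith
    have h3 : 8 * C * a * ‖z‖ ^ 2 ≤ 1 * ‖z‖ ^ 2 := mul_le_mul_of_nonneg_right ha3 (by positivity)
    have h4 : 0 ≤ (K₁ + 4 * C + 1) * a ^ 2 := by positivity
    nlinarith [sq_nonneg (‖z‖ - 4 * a * C)]
  · have h2 : 2 * a * G s e z ≤ 2 * (C * (2 * (1 + sqSize z))) := by
      have h3 := mul_le_mul_of_nonneg_left ((le_abs_self _).trans hGz2)
        (by positivity : 0 ≤ 2 * a)
      have h4 : 2 * a * (C * (2 * (1 + sqSize z))) ≤ 2 * 1 * (C * (2 * (1 + sqSize z))) := by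
        gcongr
      linarith
    have h5 : 0 ≤ (K₁ + 8 * C ^ 2) * (1 + sqSize z) := by positivity
    linarith

end Lyapunov

/-! ### A scalar recursion -/

section Recursion

lemma stepSize_pos {α t₀ ξ : ℝ} (hα : 0 < α) (ht₀ : 0 < t₀) (t : ℕ) :
    0 < stepSize α t₀ ξ t :=
  div_pos hα (Real.rpow_pos_of_pos (by positivity) ξ)

lemma stepSize_succ_le {α t₀ ξ : ℝ} (hα : 0 < α) (ht₀ : 0 < t₀) (hξ : 0 ≤ ξ) (t : ℕ) :
    stepSize α t₀ ξ (t + 1) ≤ stepSize α t₀ ξ t := by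
  unfold stepSize
  refine div_le_div_of_nonneg_left hα.le (Real.rpow_pos_of_pos (by positivity) ξ)
    (Real.rpow_le_rpow (by positivity) ?_ hξ)
  push_cast
  linarith

lemma stepSize_le {α t₀ ξ : ℝ} (hα : 0 < α) (ht₀ : 1 ≤ t₀) (hξ : 0 ≤ ξ) (t : ℕ) :
    stepSize α t₀ ξ t ≤ α :=
  div_le_self hα.le (Real.one_le_rpow (by linarith [Nat.cast_nonneg (α := ℝ) t]) hξ)

lemma stepSize_sq {α t₀ ξ : ℝ} (ht₀ : 0 < t₀) (t : ℕ) :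
    stepSize α t₀ ξ t ^ 2 = α ^ 2 / ((t : ℝ) + t₀) ^ (2 * ξ) := by
  rw [stepSize, div_pow, mul_comm 2 ξ, Real.rpow_mul (by positivity), Real.rpow_two]

lemma tendsto_stepSize {α t₀ ξ : ℝ} (hξ : 0 < ξ) :
    Tendsto (stepSize α t₀ ξ) atTop (𝓝 0) := by
  refine Tendsto.div_atTop tendsto_const_nhds ((tendsto_rpow_atTop hξ).comp ?_)
  exact tendsto_atTop_add_const_right _ _ tendsto_natCast_atTop_atTop

/-- `1 - 1 / τ ≤ (τ / (τ + 1)) ^ ρ` for `ρ ≤ 1`, divided by `τ ^ ρ`. -/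
lemma rpow_mul_one_sub_le {τ ρ : ℝ} (hτ : 1 ≤ τ) (hρ : ρ ≤ 1) :
    (1 - 1 / τ) / τ ^ ρ ≤ 1 / (τ + 1) ^ ρ := by
  have hτ0 : 0 < τ := by linarith
  have h1 : ((τ + 1) / τ) ^ ρ ≤ (τ + 1) / τ := by
    conv_rhs => rw [← Real.rpow_one ((τ + 1) / τ)]
    exact Real.rpow_le_rpow_of_exponent_le (by rw [le_div_iff₀ hτ0]; linarith) hρ
  rw [Real.div_rpow (by positivity) hτ0.le, div_le_iff₀ (by positivity)] at h1
  rw [div_le_div_iff₀ (by positivity) (by positivity), one_mul]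
  calc (1 - 1 / τ) * (τ + 1) ^ ρ ≤ (1 - 1 / τ) * ((τ + 1) / τ * τ ^ ρ) :=
        mul_le_mul_of_nonneg_left h1 (by rw [sub_nonneg, div_le_one hτ0]; exact hτ)
    _ = (1 - 1 / τ ^ 2) * τ ^ ρ := by
        field_simp
        ring
    _ ≤ 1 * τ ^ ρ := mul_le_mul_of_nonneg_right (by
        have : 0 < 1 / τ ^ 2 := by positivity
        linarith) (by positivity)
    _ = τ ^ ρ := one_mul _

lemma stepSize_sub_le {α t₀ ξ : ℝ} (hα : 1 ≤ α) (ht₀ : 1 ≤ t₀) (hξ1 : ξ ≤ 1)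
    (t : ℕ) : stepSize α t₀ ξ t - stepSize α t₀ ξ (t + 1) ≤ stepSize α t₀ ξ t ^ 2 := by
  set τ : ℝ := (t : ℝ) + t₀ with hτdef
  have hτ : 1 ≤ τ := by linarith [Nat.cast_nonneg (α := ℝ) t]
  have hτ0 : 0 < τ := by linarith
  have h1 := mul_le_mul_of_nonneg_left (rpow_mul_one_sub_le hτ hξ1) (by linarith : 0 ≤ α)
  have h2 : τ ^ ξ ≤ τ := by
    conv_rhs => rw [← Real.rpow_one τ]
    exact Real.rpow_le_rpow_of_exponent_le hτ hξ1
  have e1 : stepSize α t₀ ξ (t + 1) = α * (1 / (τ + 1) ^ ξ) := by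
    rw [stepSize, mul_one_div]
    congr 2
    push_cast
    ring
  have e2 : stepSize α t₀ ξ t = α / τ ^ ξ := rfl
  have hpos : 0 < τ ^ ξ := Real.rpow_pos_of_pos hτ0 ξ
  rw [e1, e2]
  have h3 : α / τ ^ ξ - α * ((1 - 1 / τ) / τ ^ ξ) = α / τ ^ ξ * (1 / τ) := by
    field_simp
    ring
  have h4 : α / τ ^ ξ * (1 / τ) ≤ α / τ ^ ξ * (α / τ ^ ξ) := by
    refine mul_le_mul_of_nonneg_left ?_ (by positivity)
    exact div_le_div₀ (by linarith) hα hpos h2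
  rw [sq]
  linarith

/-- The recursion `Φ_{t+1} ≤ (1 - c α_t) Φ_t + K α_t²` with `α_t = α / (t + t₀)^ξ` and `α c > 1`:
the initial value is forgotten at rate `(t + t₀)^(-⌊α c⌋)`, and the noise contributes
`(t + t₀)^(-(2 ξ - 1))`. -/
lemma recursion_le {Φ : ℕ → ℝ} {α t₀ ξ c K Φ₁ : ℝ} {t₁ : ℕ} (hα : 0 < α) (ht₀ : 1 ≤ t₀)
    (hξ1 : ξ ≤ 1) (hK : 0 ≤ K) (hc : 0 < c) (hκ : 1 < α * c)
    (hrec : ∀ t, t₁ ≤ t → Φ (t + 1) ≤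
      (1 - c * stepSize α t₀ ξ t) * Φ t + K * stepSize α t₀ ξ t ^ 2)
    (hsmall : ∀ t, t₁ ≤ t → c * stepSize α t₀ ξ t ≤ 1)
    (hΦ₁ : Φ t₁ ≤ Φ₁) (hΦ₁0 : 0 ≤ Φ₁) :
    ∀ t, t₁ ≤ t → Φ t ≤ Φ₁ * (((t₁ : ℝ) + t₀) / ((t : ℝ) + t₀)) ^ ⌊α * c⌋₊ +
      K * α ^ 2 / (α * c - 1) / ((t : ℝ) + t₀) ^ (2 * ξ - 1) := by
  have hκ1 : 0 < α * c - 1 := by linarith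
  intro t ht
  induction t, ht using Nat.le_induction with
  | base =>
    have : (t₁ : ℝ) + t₀ ≠ 0 := by positivity
    rw [div_self this, one_pow, mul_one]
    have : 0 ≤ K * α ^ 2 / (α * c - 1) / ((t₁ : ℝ) + t₀) ^ (2 * ξ - 1) :=
      div_nonneg (by positivity) (Real.rpow_nonneg (by positivity) _)
    linarith
  | succ t ht ih =>
    set n := ⌊α * c⌋₊
    set τ : ℝ := (t : ℝ) + t₀ with hτdef
    have hτ : 1 ≤ τ := by linarith [Nat.cast_nonneg (α := ℝ) t]
    have hτ0 : 0 < τ := by linarith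
    have ecast : (((t + 1 : ℕ) : ℝ) + t₀) = τ + 1 := by
      push_cast
      ring
    rw [ecast]
    set B := K * α ^ 2 / (α * c - 1) with hB
    have hB0 : 0 ≤ B := by positivity
    have hs := hsmall t ht
    have hpos : 0 < τ ^ ξ := Real.rpow_pos_of_pos hτ0 ξ
    have hle : τ ^ ξ ≤ τ := by
      conv_rhs => rw [← Real.rpow_one τ]
      exact Real.rpow_le_rpow_of_exponent_le hτ hξ1
    have hstep : stepSize α t₀ ξ t = α / τ ^ ξ := rfl
    have hκτ : α * c / τ ≤ c * stepSize α t₀ ξ t := by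
      rw [hstep, mul_comm α c, mul_div_assoc]
      exact mul_le_mul_of_nonneg_left (div_le_div_of_nonneg_left hα.le hpos hle) hc.le
    -- The transient part, by Bernoulli's inequality `1 - n / τ ≤ (1 - 1 / (τ + 1)) ^ n`.
    have htrans : 1 - c * stepSize α t₀ ξ t ≤ (τ / (τ + 1)) ^ n := by
      have hn : (n : ℝ) ≤ α * c := Nat.floor_le (by positivity)
      have hbern := one_add_mul_le_pow (a := -(1 / (τ + 1)))
        (by
          have : 1 / (τ + 1) ≤ 1 := by
            rw [div_le_one (by positivity)]
            linarith
          linarith) n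
      have e : 1 + -(1 / (τ + 1)) = τ / (τ + 1) := by
        field_simp
        ring
      rw [e] at hbern
      have h1 : (n : ℝ) * (1 / (τ + 1)) ≤ α * c / τ := by
        rw [mul_one_div]
        exact div_le_div₀ (by positivity) hn hτ0 (by linarith)
      linarith
    -- The noise part: `(α c - 1) / τ^(2 ξ)` of the contraction pays for the new noise.
    have hnoise : (1 - c * stepSize α t₀ ξ t) * (B / τ ^ (2 * ξ - 1)) +
        K * stepSize α t₀ ξ t ^ 2 ≤ B / (τ + 1) ^ (2 * ξ - 1) := by
      have h1 := mul_le_mul_of_nonneg_left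
        (rpow_mul_one_sub_le (ρ := 2 * ξ - 1) hτ (by linarith)) hB0
      have hρ : 0 < τ ^ (2 * ξ - 1) := Real.rpow_pos_of_pos hτ0 _
      have e2 : τ ^ (2 * ξ) = τ ^ (2 * ξ - 1) * τ := by
        conv_rhs => rw [← Real.rpow_add_one hτ0.ne']
        congr 1
        ring
      have h2 : K * stepSize α t₀ ξ t ^ 2 = B * ((α * c - 1) / τ) / τ ^ (2 * ξ - 1) := by
        rw [stepSize_sq (by linarith), ← hτdef, e2, hB]
        field_simp
      have h3 : (1 - c * stepSize α t₀ ξ t) * (B / τ ^ (2 * ξ - 1)) ≤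
          (1 - α * c / τ) * (B / τ ^ (2 * ξ - 1)) :=
        mul_le_mul_of_nonneg_right (by linarith) (by positivity)
      have h4 : (1 - α * c / τ) * (B / τ ^ (2 * ξ - 1)) +
          B * ((α * c - 1) / τ) / τ ^ (2 * ξ - 1) = B * ((1 - 1 / τ) / τ ^ (2 * ξ - 1)) := by
        field_simp
        ring
      rw [mul_one_div] at h1
      linarith
    have h5 := mul_le_mul_of_nonneg_left ih (by linarith : 0 ≤ 1 - c * stepSize α t₀ ξ t)
    have h6 : (1 - c * stepSize α t₀ ξ t) * (Φ₁ * ((t₁ + t₀) / τ) ^ n) ≤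
        Φ₁ * ((t₁ + t₀) / (τ + 1)) ^ n := by
      calc _ ≤ (τ / (τ + 1)) ^ n * (Φ₁ * ((t₁ + t₀) / τ) ^ n) :=
            mul_le_mul_of_nonneg_right htrans (by positivity)
        _ = Φ₁ * ((t₁ + t₀) / (τ + 1)) ^ n := by
            rw [mul_left_comm, ← mul_pow]
            congr 2
            field_simp
    rw [mul_add] at h5
    linarith [hrec t ht]

end Recursion

/-! ### The error process -/

section ErrorProcess

variable {𝒮 𝒜 : Type*} [Fintype 𝒮] [DecidableEq 𝒮] [Fintype 𝒜] {d : ℕ}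
  {M : MDP 𝒮 𝒜} {π : Policy 𝒮 𝒜} {x : 𝒮 → EuclideanSpace ℝ (Fin d)} {lam : ℝ}

/-- The error `(y, u)` of the estimates `(j, w)`, with `u` the component of `w - w₁` in `Kᗮ`. -/
def errorVec (M : MDP 𝒮 𝒜) (π : Policy 𝒮 𝒜) (x : 𝒮 → EuclideanSpace ℝ (Fin d))
    (w₁ : EuclideanSpace ℝ (Fin d)) (j : ℝ) (w : EuclideanSpace ℝ (Fin d)) :
    ℝ × EuclideanSpace ℝ (Fin d) :=
  (j - statReward M π, (constKer x)ᗮ.starProjection (w - w₁))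

lemma errorVec_snd_mem (w₁ : EuclideanSpace ℝ (Fin d)) (j : ℝ) (w : EuclideanSpace ℝ (Fin d)) :
    (errorVec M π x w₁ j w).2 ∈ (constKer x)ᗮ :=
  Submodule.starProjection_apply_mem _ _

lemma sqError_eq_sqSize (hirr : (transMatrix M π).IsIrreducible) (h0 : 0 ≤ lam) (h1 : lam < 1)
    {w₁ : EuclideanSpace ℝ (Fin d)} (hw₁ : w₁ ∈ Wstar M π x lam (statReward M π))
    (j : ℝ) (w : EuclideanSpace ℝ (Fin d)) :
    sqError (statReward M π) (Wstar M π x lam (statReward M π)) j w =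
      sqSize (errorVec M π x w₁ j w) := by
  rw [sqError, infDist_Wstar hirr h0 h1 hw₁, sqSize, errorVec]

/-- Differences of features annihilate `K`, so a step acts on the error through `errorVec` alone. -/
lemma errorVec_step (cβ : ℝ) (w₁ : EuclideanSpace ℝ (Fin d)) (a j : ℝ)
    (w e : EuclideanSpace ℝ (Fin d)) (s s' : 𝒮) (i : 𝒜) :
    errorVec M π x w₁ (j + cβ * a * (M.r s i - j))
      (w + (a * (M.r s i - j + inner ℝ (x s') w - inner ℝ (x s) w)) • e) =
    errorVec M π x w₁ j w +
      a • increment M π x cβ w₁ s i s' e (errorVec M π x w₁ j w) := by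
  have hK : inner ℝ (x s' - x s) (w - w₁ - (constKer x)ᗮ.starProjection (w - w₁)) = 0 := by
    have hmem : w - w₁ - (constKer x)ᗮ.starProjection (w - w₁) ∈ constKer x := by
      rw [Submodule.starProjection_orthogonal_val, sub_sub_cancel]
      exact Submodule.starProjection_apply_mem _ _
    obtain ⟨k, hk⟩ := hmem
    rw [inner_sub_left, hk, hk, sub_self]
  have hδ : inner ℝ (x s' - x s) (w₁ + (constKer x)ᗮ.starProjection (w - w₁)) =
      inner ℝ (x s') w - inner ℝ (x s) w := by
    rw [← inner_sub_left, ← sub_eq_zero, ← inner_sub_right, ← neg_eq_zero, ← inner_neg_right, ← hK]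
    congr 1
    abel
  refine Prod.ext ?_ ?_
  · simp only [errorVec, increment, Prod.fst_add, Prod.smul_fst, smul_eq_mul]
    ring
  · simp only [errorVec, increment, Prod.snd_add, Prod.smul_snd, hδ]
    rw [add_sub_right_comm, map_add, map_smul, smul_smul]
    congr 3
    ring

lemma norm_trace_step_le (h0 : 0 ≤ lam) (h1 : lam < 1) (e : EuclideanSpace ℝ (Fin d)) (s : 𝒮)
    (he : ‖e‖ ≤ ‖x‖ / (1 - lam)) : ‖lam • e + x s‖ ≤ ‖x‖ / (1 - lam) := by
  have hpos : 0 < 1 - lam := by linarith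
  calc ‖lam • e + x s‖ ≤ lam * (‖x‖ / (1 - lam)) + ‖x‖ := by
        refine (norm_add_le _ _).trans (add_le_add ?_ (norm_le_pi_norm x _))
        rw [norm_smul, Real.norm_of_nonneg h0]
        exact mul_le_mul_of_nonneg_left he h0
    _ = ‖x‖ / (1 - lam) := by
        field_simp
        ring

lemma norm_trace_le (h0 : 0 ≤ lam) (h1 : lam < 1) (s : ℕ → 𝒮) (t : ℕ) :
    ‖trace x lam s t‖ ≤ ‖x‖ / (1 - lam) := by
  induction t with
  | zero =>
    rw [trace, le_div_iff₀ (by linarith)]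
    nlinarith [norm_le_pi_norm x (s 0), norm_nonneg (x (s 0))]
  | succ t ih => exact norm_trace_step_le h0 h1 _ _ ih

lemma isHistory_trace (x : 𝒮 → EuclideanSpace ℝ (Fin d)) (lam : ℝ) (t : ℕ) :
    IsHistory t fun (s : ℕ → 𝒮) (_ : ℕ → 𝒜) => trace x lam s t := by
  induction t with
  | zero => intro s s' a a' h _; simp only [trace, h 0 le_rfl]
  | succ t ih =>
    intro s s' a a' h h'
    have := ih s s' a a' (fun i hi => h i (by omega)) fun i hi => h' i (by omega)
    simp only [trace, h (t + 1) le_rfl] at this ⊢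
    rw [this]

lemma isHistory_Jhat (r : 𝒮 → 𝒜 → ℝ) (β : ℕ → ℝ) (J₀ : ℝ) (t : ℕ) :
    IsHistory t fun s a => Jhat r β J₀ s a t := by
  induction t with
  | zero => intro s s' a a' _ _; rfl
  | succ t ih =>
    intro s s' a a' h h'
    have := ih s s' a a' (fun i hi => h i (by omega)) fun i hi => h' i (by omega)
    simp only at this
    simp only [Jhat, this, h t (by omega), h' t (by omega)]

lemma isHistory_weight (r : 𝒮 → 𝒜 → ℝ) (x : 𝒮 → EuclideanSpace ℝ (Fin d)) (lam : ℝ)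
    (α β : ℕ → ℝ) (w₀ : EuclideanSpace ℝ (Fin d)) (J₀ : ℝ) (t : ℕ) :
    IsHistory t fun s a => weight r x lam α β w₀ J₀ s a t := by
  induction t with
  | zero => intro s s' a a' _ _; rfl
  | succ t ih =>
    intro s s' a a' h h'
    have h1 := ih s s' a a' (fun i hi => h i (by omega)) fun i hi => h' i (by omega)
    have h2 := isHistory_Jhat r β J₀ t s s' a a' (fun i hi => h i (by omega))
      fun i hi => h' i (by omega)
    have h3 := isHistory_trace x lam t s s' a a' (fun i hi => h i (by omega))
      fun i hi => h' i (by omega)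
    simp only at h1 h2 h3
    simp only [weight, h1, h2, h3, h t (by omega), h' t (by omega), h (t + 1) le_rfl]

/-- The error of the iterates along a path, with `β_t = cβ α_t`. -/
def errorAt (M : MDP 𝒮 𝒜) (π : Policy 𝒮 𝒜) (x : 𝒮 → EuclideanSpace ℝ (Fin d)) (lam cβ : ℝ)
    (w₁ : EuclideanSpace ℝ (Fin d)) (α : ℕ → ℝ) (w₀ : EuclideanSpace ℝ (Fin d)) (J₀ : ℝ)
    (s : ℕ → 𝒮) (a : ℕ → 𝒜) (t : ℕ) : ℝ × EuclideanSpace ℝ (Fin d) :=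
  errorVec M π x w₁ (Jhat M.r (fun k => cβ * α k) J₀ s a t)
    (weight M.r x lam α (fun k => cβ * α k) w₀ J₀ s a t)

lemma errorAt_succ (cβ : ℝ) (w₁ : EuclideanSpace ℝ (Fin d)) (α : ℕ → ℝ)
    (w₀ : EuclideanSpace ℝ (Fin d)) (J₀ : ℝ) (s : ℕ → 𝒮) (a : ℕ → 𝒜) (t : ℕ) :
    errorAt M π x lam cβ w₁ α w₀ J₀ s a (t + 1) =
      errorAt M π x lam cβ w₁ α w₀ J₀ s a t +
        α t • increment M π x cβ w₁ (s t) (a t) (s (t + 1)) (trace x lam s t)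
          (errorAt M π x lam cβ w₁ α w₀ J₀ s a t) := by
  rw [errorAt, Jhat, weight, errorVec_step]
  rfl

lemma isHistory_errorAt (cβ : ℝ) (w₁ : EuclideanSpace ℝ (Fin d)) (α : ℕ → ℝ)
    (w₀ : EuclideanSpace ℝ (Fin d)) (J₀ : ℝ) (t : ℕ) :
    IsHistory t fun s a => errorAt M π x lam cβ w₁ α w₀ J₀ s a t := by
  intro s s' a a' h h'
  have h1 := isHistory_Jhat M.r (fun k => cβ * α k) J₀ t s s' a a' h h'
  have h2 := isHistory_weight M.r x lam α (fun k => cβ * α k) w₀ J₀ t s s' a a' h h'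
  simp only at h1 h2
  simp only [errorAt, h1, h2]

/-- In a fixed number of steps the error grows at most by a fixed factor, on every path. -/
lemma exists_errorAt_le (M : MDP 𝒮 𝒜) (π : Policy 𝒮 𝒜) (x : 𝒮 → EuclideanSpace ℝ (Fin d))
    (h0 : 0 ≤ lam) (h1 : lam < 1) (cβ : ℝ) (w₁ : EuclideanSpace ℝ (Fin d)) {α : ℕ → ℝ} {a₁ : ℝ}
    (hα0 : ∀ t, 0 ≤ α t) (hα : ∀ t, α t ≤ a₁) (t₁ : ℕ) :
    ∃ L : ℝ, 0 < L ∧ ∀ w₀ J₀ s a, ∀ t ≤ t₁,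
      sqSize (errorAt M π x lam cβ w₁ α w₀ J₀ s a t) ≤
        L * (1 + sqSize (errorVec M π x w₁ J₀ w₀)) := by
  have hE₀ : 0 ≤ ‖x‖ / (1 - lam) := div_nonneg (norm_nonneg _) (by linarith)
  obtain ⟨D, hD, hDb⟩ := exists_increment_bound M π x cβ w₁ hE₀
  have ha₁ : 0 ≤ a₁ := (hα0 0).trans (hα 0)
  have hone : 1 ≤ 1 + a₁ * D := by nlinarith [mul_nonneg ha₁ hD]
  refine ⟨4 * ((1 + a₁ * D) ^ t₁) ^ 2, by positivity, fun w₀ J₀ s a t ht => ?_⟩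
  set z := errorAt M π x lam cβ w₁ α w₀ J₀ s a
  have hz : ∀ t, 1 + ‖z t‖ ≤ (1 + a₁ * D) ^ t * (1 + ‖z 0‖) := fun t => by
    induction t with
    | zero => simp
    | succ t ih =>
      have hΔ := hDb (s t) (a t) (s (t + 1)) _ (z t) (norm_trace_le (x := x) h0 h1 s t)
      have h2 : ‖z (t + 1)‖ ≤ ‖z t‖ + a₁ * (D * (1 + ‖z t‖)) := by
        simp only [z]
        rw [errorAt_succ]
        refine (norm_add_le _ _).trans (add_le_add le_rfl ?_)
        rw [norm_smul, Real.norm_of_nonneg (hα0 t)]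
        exact mul_le_mul (hα t) hΔ (norm_nonneg _) ha₁
      calc 1 + ‖z (t + 1)‖ ≤ (1 + a₁ * D) * (1 + ‖z t‖) := by linarith
        _ ≤ (1 + a₁ * D) * ((1 + a₁ * D) ^ t * (1 + ‖z 0‖)) :=
            mul_le_mul_of_nonneg_left ih (by positivity)
        _ = _ := by ring
  have h3 : ‖z t‖ ≤ (1 + a₁ * D) ^ t₁ * (1 + ‖z 0‖) := by
    have := mul_le_mul_of_nonneg_right (pow_le_pow_right₀ hone ht)
      (by positivity : 0 ≤ 1 + ‖z 0‖)
    linarith [hz t]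
  have hz0 : z 0 = errorVec M π x w₁ J₀ w₀ := rfl
  have h4 : (1 + ‖z 0‖) ^ 2 ≤ 2 * (1 + sqSize (z 0)) := by
    nlinarith [norm_sq_le_sqSize (z 0), sq_nonneg (‖z 0‖ - 1)]
  calc sqSize (z t) ≤ 2 * ‖z t‖ ^ 2 := sqSize_le _
    _ ≤ 2 * ((1 + a₁ * D) ^ t₁ * (1 + ‖z 0‖)) ^ 2 := by
        gcongr
    _ = 2 * ((1 + a₁ * D) ^ t₁) ^ 2 * (1 + ‖z 0‖) ^ 2 := by ring
    _ ≤ 2 * ((1 + a₁ * D) ^ t₁) ^ 2 * (2 * (1 + sqSize (z 0))) :=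
        mul_le_mul_of_nonneg_left h4 (by positivity)
    _ = 4 * ((1 + a₁ * D) ^ t₁) ^ 2 * (1 + sqSize (errorVec M π x w₁ J₀ w₀)) := by
        rw [hz0]
        ring

end ErrorProcess

/-! ### The mean square error -/

section MeanSquare

variable {𝒮 𝒜 Ω : Type*} [Fintype 𝒮] [DecidableEq 𝒮] [Fintype 𝒜] [MeasurableSpace Ω]
  {ℙ : Measure Ω} [IsProbabilityMeasure ℙ] {d : ℕ}
  {M : MDP 𝒮 𝒜} {π : Policy 𝒮 𝒜} {S : ℕ → Ω → 𝒮} {A : ℕ → Ω → 𝒜}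
  {x : 𝒮 → EuclideanSpace ℝ (Fin d)} {lam : ℝ}

/-- From a time `t₁` on, the mean of the Lyapunov function obeys the scalar recursion; up to `t₁`
the error is bounded on every path. -/
lemma exists_integral_sqSize_le (hirr : (transMatrix M π).IsIrreducible)
    (hSA : IsTrajectory M π ℙ S A) (h0 : 0 ≤ lam) (h1 : lam < 1) {cβ c : ℝ} (hc : 0 < c)
    (hneg : AugNegDef M π x lam cβ c) {w₁ : EuclideanSpace ℝ (Fin d)}
    (hw₁ : w₁ ∈ Wstar M π x lam (statReward M π)) {α t₀ ξ : ℝ} (hα : 1 ≤ α) (ht₀ : 1 ≤ t₀)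
    (hξ0 : 0 < ξ) (hξ1 : ξ ≤ 1) (hκ : 1 < α * c) :
    ∃ (t₁ : ℕ) (L K : ℝ), 0 < L ∧ 0 < K ∧ ∀ w₀ J₀ t,
      (t ≤ t₁ → ∫ ω, sqSize (errorAt M π x lam cβ w₁ (stepSize α t₀ ξ) w₀ J₀
        (fun k => S k ω) (fun k => A k ω) t) ∂ℙ ≤ L * (1 + sqSize (errorVec M π x w₁ J₀ w₀))) ∧
      (t₁ ≤ t → ∫ ω, sqSize (errorAt M π x lam cβ w₁ (stepSize α t₀ ξ) w₀ J₀
        (fun k => S k ω) (fun k => A k ω) t) ∂ℙ ≤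
          L * (1 + sqSize (errorVec M π x w₁ J₀ w₀)) *
            (((t₁ : ℝ) + t₀) / ((t : ℝ) + t₀)) ^ ⌊α * c⌋₊ +
          K / ((t : ℝ) + t₀) ^ (2 * ξ - 1)) := by
  have hα0 : 0 < α := by linarith
  have ht₀0 : 0 < t₀ := by linarith
  have hE₀ : 0 ≤ ‖x‖ / (1 - lam) := div_nonneg (norm_nonneg _) (by linarith)
  obtain ⟨V, K, a₀, hK, ha₀, hV⟩ := exists_lyapunov hirr h0 h1 hc hneg hw₁ hE₀
    fun e s he => norm_trace_step_le h0 h1 e s he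
  set a := stepSize α t₀ ξ with ha
  have ha0 : ∀ t, 0 < a t := fun t => stepSize_pos hα0 ht₀0 t
  obtain ⟨t₁, ht₁⟩ : ∃ t₁, ∀ t, t₁ ≤ t → a t ≤ min a₀ (1 / c) := by
    have := (tendsto_stepSize (α := α) (t₀ := t₀) hξ0).eventually_le_const
      (lt_min ha₀ (by positivity : 0 < 1 / c))
    exact eventually_atTop.1 this
  obtain ⟨L, hL, hLb⟩ := exists_errorAt_le M π x h0 h1 cβ w₁ (α := a) (a₁ := α)
    (fun t => (ha0 t).le) (fun t => stepSize_le hα0 ht₀ hξ0.le t) t₁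
  set B := K * α ^ 2 / (α * c - 1)
  have hκ1 : 0 < α * c - 1 := by linarith
  have hB : 0 ≤ B := by positivity
  refine ⟨t₁, L + 2 * (K * (1 + L)), 2 * B + K * α ^ 2, by positivity, by positivity,
    fun w₀ J₀ => ?_⟩
  set N₀ := sqSize (errorVec M π x w₁ J₀ w₀)
  have hN₀ : 0 ≤ N₀ := (sq_nonneg _).trans (norm_sq_le_sqSize _)
  set z : (ℕ → 𝒮) → (ℕ → 𝒜) → ℕ → ℝ × EuclideanSpace ℝ (Fin d) :=
    errorAt M π x lam cβ w₁ a w₀ J₀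
  have hzhist : ∀ t, IsHistory t fun s b => z s b t := fun t => isHistory_errorAt cβ w₁ a w₀ J₀ t
  have hehist : ∀ t, IsHistory t fun (s : ℕ → 𝒮) (_ : ℕ → 𝒜) => trace x lam s t :=
    fun t => isHistory_trace x lam t
  have hdrift : ∀ t, t₁ ≤ t → ∀ s b,
      ∑ i, ∑ s', π.prob (s t) i * M.p (s t) i s' *
        V (a (t + 1)) s' (lam • trace x lam s t + x s')
          (z s b t + a t • increment M π x cβ w₁ (s t) i s' (trace x lam s t) (z s b t)) ≤
            (1 - c * a t) * V (a t) (s t) (trace x lam s t) (z s b t) + K * a t ^ 2 ∧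
        sqSize (z s b t) ≤ 2 * V (a t) (s t) (trace x lam s t) (z s b t) + K * a t ^ 2 ∧
        V (a t) (s t) (trace x lam s t) (z s b t) ≤ K * (1 + sqSize (z s b t)) :=
    fun t ht s b => hV (a t) (a (t + 1)) (ha0 _).le (stepSize_succ_le hα0 ht₀0 hξ0.le t)
      ((ht₁ t ht).trans (min_le_left _ _)) (stepSize_sub_le hα ht₀ hξ1 t) (s t) _ (z s b t)
      (norm_trace_le h0 h1 s t) (errorVec_snd_mem _ _ _)
  have hzi : ∀ t, Integrable
      (fun ω => sqSize (z (fun k => S k ω) (fun k => A k ω) t)) ℙ := fun t =>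
    hSA.integrable (F := fun s b => sqSize (z s b t)) fun s s' b b' h h' =>
      congrArg sqSize (hzhist t s s' b b' h h')
  have hVhist : ∀ t, IsHistory t fun s b =>
      V (a t) (s t) (trace x lam s t) (z s b t) := fun t s s' b b' h h' => by
    have e1 := hzhist t s s' b b' h h'
    have e2 := hehist t s s' b b' h h'
    simp only at e1 e2
    simp only [e1, e2, h t le_rfl]
  have hVi : ∀ t, Integrable (fun ω => V (a t) (S t ω) (trace x lam (fun k => S k ω) t)
      (z (fun k => S k ω) (fun k => A k ω) t)) ℙ := fun t => hSA.integrable (hVhist t)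
  set Φ : ℕ → ℝ := fun t => ∫ ω, V (a t) (S t ω) (trace x lam (fun k => S k ω) t)
      (z (fun k => S k ω) (fun k => A k ω) t) ∂ℙ
  set F : ℕ → (ℕ → 𝒮) → (ℕ → 𝒜) → 𝒜 → 𝒮 → ℝ := fun t s b i s' =>
    V (a (t + 1)) s' (lam • trace x lam s t + x s')
      (z s b t + a t • increment M π x cβ w₁ (s t) i s' (trace x lam s t) (z s b t))
  have hFhist : ∀ t, IsHistory t (F t) := fun t s s' b b' h h' => by
    have e1 := hzhist t s s' b b' h h'
    have e2 := hehist t s s' b b' h h'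
    simp only at e1 e2
    simp only [F, e1, e2, h t le_rfl]
  have hrec : ∀ t, t₁ ≤ t → Φ (t + 1) ≤ (1 - c * a t) * Φ t + K * a t ^ 2 := fun t ht => by
    have e1 : Φ (t + 1) =
        ∫ ω, F t (fun k => S k ω) (fun k => A k ω) (A t ω) (S (t + 1) ω) ∂ℙ := by
      refine integral_congr_ae (Eventually.of_forall fun ω => ?_)
      simp only [F, z, errorAt_succ, trace]
    have hi : Integrable (fun ω => ∑ i, ∑ s', π.prob (S t ω) i * M.p (S t ω) i s' *
        F t (fun k => S k ω) (fun k => A k ω) i s') ℙ :=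
      hSA.integrable (n := t) (F := fun s b => ∑ i, ∑ s', π.prob (s t) i * M.p (s t) i s' *
        F t s b i s') fun s s' b b' h h' => by
          simp only [hFhist t s s' b b' h h', h t le_rfl]
    rw [e1, hSA.integral_step (hFhist t)]
    refine (integral_mono hi (((hVi t).const_mul (1 - c * a t)).add (integrable_const _))
      fun ω => (hdrift t ht (fun k => S k ω) (fun k => A k ω)).1).trans (le_of_eq ?_)
    simp only [Pi.add_apply]
    rw [integral_add ((hVi t).const_mul _) (integrable_const _), integral_const_mul]
    simp [Φ]
  have hsmall : ∀ t, t₁ ≤ t → c * a t ≤ 1 := fun t ht => by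
    have := (ht₁ t ht).trans (min_le_right _ _)
    rw [le_div_iff₀ hc] at this
    linarith
  have hΦ₁ : Φ t₁ ≤ K * (1 + L) * (1 + N₀) := by
    have : Φ t₁ ≤ ∫ _, K * (1 + L) * (1 + N₀) ∂ℙ := by
      refine integral_mono (hVi t₁) (integrable_const _) fun ω => ?_
      refine (hdrift t₁ le_rfl (fun k => S k ω) (fun k => A k ω)).2.2.trans ?_
      have := hLb w₀ J₀ (fun k => S k ω) (fun k => A k ω) t₁ le_rfl
      rw [mul_assoc]
      refine mul_le_mul_of_nonneg_left ?_ hK.le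
      change 1 + sqSize (errorAt M π x lam cβ w₁ a w₀ J₀ _ _ t₁) ≤ _
      linarith
    simpa using this
  have hΦ := recursion_le hα0 ht₀ hξ1 hK.le hc hκ hrec hsmall hΦ₁ (by positivity)
  intro t
  refine ⟨fun ht => ?_, fun ht => ?_⟩
  · have : ∫ ω, sqSize (z (fun k => S k ω) (fun k => A k ω) t) ∂ℙ ≤
        ∫ _, L * (1 + N₀) ∂ℙ :=
      integral_mono (hzi t) (integrable_const _) fun ω => hLb w₀ J₀ _ _ t ht
    rw [integral_const, probReal_univ, one_smul] at this
    refine this.trans (mul_le_mul_of_nonneg_right ?_ (by positivity))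
    have : 0 ≤ 2 * (K * (1 + L)) := by positivity
    linarith
  · have h2 : ∫ ω, sqSize (z (fun k => S k ω) (fun k => A k ω) t) ∂ℙ ≤
        2 * Φ t + K * a t ^ 2 := by
      refine (integral_mono (hzi t) (((hVi t).const_mul 2).add (integrable_const (K * a t ^ 2)))
        fun ω => (hdrift t ht (fun k => S k ω) (fun k => A k ω)).2.1).trans (le_of_eq ?_)
      simp only [Pi.add_apply]
      rw [integral_add ((hVi t).const_mul _) (integrable_const _), integral_const_mul]
      simp [Φ]
    set τ : ℝ := (t : ℝ) + t₀ with hτdef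
    have hτ : 1 ≤ τ := by linarith [Nat.cast_nonneg (α := ℝ) t]
    have hρ : 0 < τ ^ (2 * ξ - 1) := Real.rpow_pos_of_pos (by linarith) _
    have h3 : K * a t ^ 2 ≤ K * α ^ 2 / τ ^ (2 * ξ - 1) := by
      rw [ha, stepSize_sq ht₀0, ← hτdef, mul_div_assoc]
      refine mul_le_mul_of_nonneg_left (div_le_div_of_nonneg_left (by positivity) hρ ?_) hK.le
      exact Real.rpow_le_rpow_of_exponent_le hτ (by linarith)
    have h4 := hΦ t ht
    have h5 : 0 ≤ L * (1 + N₀) * ((t₁ + t₀) / τ) ^ ⌊α * c⌋₊ := by positivity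
    rw [add_div (2 * B), add_mul L, add_mul (L * (1 + N₀)), mul_div_assoc 2 B]
    linarith

/-- For `κ ≥ 3` the exponent `min (2 ξ - 1) (⌊κ⌋ - 1)` is `2 ξ - 1`. -/
lemma exists_mean_sq_bound (hirr : (transMatrix M π).IsIrreducible)
    (hSA : IsTrajectory M π ℙ S A) (h0 : 0 ≤ lam) (h1 : lam < 1) {cβ c : ℝ} (hc : 0 < c)
    (hneg : AugNegDef M π x lam cβ c) {w₁ : EuclideanSpace ℝ (Fin d)}
    (hw₁ : w₁ ∈ Wstar M π x lam (statReward M π)) {α t₀ ξ : ℝ} (hα : 1 ≤ α) (ht₀ : 2 ≤ t₀)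
    (hξ0 : 1 / 2 < ξ) (hξ1 : ξ ≤ 1) (hκ : 3 ≤ α * c) :
    ∃ C : ℝ, 0 < C ∧ ∀ w₀ J₀ (t : ℕ), 1 ≤ t →
      ∫ ω, sqSize (errorAt M π x lam cβ w₁ (stepSize α t₀ ξ) w₀ J₀
        (fun k => S k ω) (fun k => A k ω) t) ∂ℙ ≤
      C * (t₀ / (t : ℝ)) ^ ⌊α * c⌋₊ * sqSize (errorVec M π x w₁ J₀ w₀) +
        C * (Real.log ((t : ℝ) + t₀) /
          ((t : ℝ) + t₀) ^ (min (2 * ξ - 1) ((⌊α * c⌋₊ : ℝ) - 1))) := by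
  obtain ⟨t₁, L, K, hL, hK, hE⟩ := exists_integral_sqSize_le (S := S) (A := A) hirr hSA h0 h1 hc
    hneg hw₁ hα (by linarith : 1 ≤ t₀) (by linarith : 0 < ξ) hξ1 (by linarith)
  set n := ⌊α * c⌋₊
  have hn : 3 ≤ n := Nat.le_floor (by exact_mod_cast hκ)
  have hnR : (3 : ℝ) ≤ n := by exact_mod_cast hn
  have ht₀0 : 0 < t₀ := by linarith
  set τ₁ : ℝ := (t₁ : ℝ) + t₀ with hτ₁
  have hτ₁1 : 1 ≤ τ₁ := by linarith [Nat.cast_nonneg (α := ℝ) t₁]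
  rw [min_eq_left (by linarith)]
  refine ⟨L * (τ₁ / t₀) ^ n + 2 * (L * τ₁ ^ n + K), by positivity, fun w₀ J₀ t ht => ?_⟩
  set N₀ := sqSize (errorVec M π x w₁ J₀ w₀)
  have hN₀ : 0 ≤ N₀ := (sq_nonneg _).trans (norm_sq_le_sqSize _)
  set I := ∫ ω, sqSize (errorAt M π x lam cβ w₁ (stepSize α t₀ ξ) w₀ J₀
        (fun k => S k ω) (fun k => A k ω) t) ∂ℙ
  set τ : ℝ := (t : ℝ) + t₀ with hτ
  have ht1 : (1 : ℝ) ≤ t := by exact_mod_cast ht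
  have hτ2 : 2 ≤ τ := by linarith
  set ρ := τ ^ (2 * ξ - 1)
  have hρ : 0 < ρ := Real.rpow_pos_of_pos (by linarith) _
  have hρτ : ρ ≤ τ := by
    conv_rhs => rw [← Real.rpow_one τ]
    exact Real.rpow_le_rpow_of_exponent_le (by linarith) (by linarith)
  -- For `t ≤ t₁` both `τ₁ / t` and `τ₁ ^ n / ρ` are at least `1`.
  have key : I ≤ L * N₀ * (τ₁ / t) ^ n + (L * τ₁ ^ n + K) / ρ := by
    have hKρ : 0 ≤ K / ρ := by positivity
    rcases le_total t t₁ with hle | hle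
    · have hI := (hE w₀ J₀ t).1 hle
      have hleR : (t : ℝ) ≤ t₁ := by exact_mod_cast hle
      have e1 : 1 ≤ (τ₁ / t) ^ n := by
        refine one_le_pow₀ ?_
        rw [le_div_iff₀ (by linarith)]
        linarith
      have e2 : 1 ≤ τ₁ ^ n / ρ := by
        rw [le_div_iff₀ hρ, one_mul]
        have := le_self_pow₀ hτ₁1 (by omega : n ≠ 0)
        linarith
      have e3 := mul_le_mul_of_nonneg_left e1 (by positivity : 0 ≤ L * N₀)
      have e4 := mul_le_mul_of_nonneg_left e2 hL.le
      rw [add_div (L * τ₁ ^ n), mul_div_assoc L]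
      linarith
    · have hI := (hE w₀ J₀ t).2 hle
      have e1 : (τ₁ / τ) ^ n ≤ (τ₁ / t) ^ n := by
        refine pow_le_pow_left₀ (by positivity) ?_ n
        exact div_le_div_of_nonneg_left (by positivity) (by linarith) (by linarith)
      have e2 : (τ₁ / τ) ^ n ≤ τ₁ ^ n / ρ := by
        rw [div_pow]
        refine div_le_div_of_nonneg_left (by positivity) hρ (hρτ.trans ?_)
        exact le_self_pow₀ (by linarith) (by omega)
      have e3 := mul_le_mul_of_nonneg_left e1 (by positivity : 0 ≤ L * N₀)
      have e4 := mul_le_mul_of_nonneg_left e2 hL.le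
      rw [add_div (L * τ₁ ^ n), mul_div_assoc L]
      linarith
  have hlog : 1 ≤ 2 * Real.log τ := by
    have h2 := Real.log_le_log two_pos hτ2
    linarith [Real.log_two_gt_d9]
  have e1 : (τ₁ / t) ^ n = (τ₁ / t₀) ^ n * (t₀ / t) ^ n := by
    rw [← mul_pow]
    congr 1
    field_simp
  have e2 : (L * τ₁ ^ n + K) / ρ ≤ 2 * (L * τ₁ ^ n + K) * (Real.log τ / ρ) := by
    have h3 : 0 ≤ (L * τ₁ ^ n + K) / ρ := by positivity
    calc _ = (L * τ₁ ^ n + K) / ρ * 1 := (mul_one _).symm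
      _ ≤ (L * τ₁ ^ n + K) / ρ * (2 * Real.log τ) := mul_le_mul_of_nonneg_left hlog h3
      _ = _ := by ring
  have hlog0 : 0 ≤ Real.log τ / ρ := div_nonneg (by linarith) hρ.le
  have e3 : 0 ≤ 2 * (L * τ₁ ^ n + K) * (t₀ / t) ^ n * N₀ := by positivity
  have e4 : 0 ≤ L * (τ₁ / t₀) ^ n * (Real.log τ / ρ) := by positivity
  rw [e1] at key
  linarith

end MeanSquare

end AvgTD

end

theorem theorem2 {𝒮 𝒜 Ω : Type*} [Fintype 𝒮] [DecidableEq 𝒮] [Fintype 𝒜]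
    [MeasurableSpace Ω] (ℙ : Measure Ω) [IsProbabilityMeasure ℙ]
    (M : AvgTD.MDP 𝒮 𝒜) (π : AvgTD.Policy 𝒮 𝒜)
    (hirr : (AvgTD.transMatrix M π).IsIrreducible)
    (haper : AvgTD.Aperiodic (AvgTD.transMatrix M π))
    (S : ℕ → Ω → 𝒮) (A : ℕ → Ω → 𝒜) (hSA : AvgTD.IsTrajectory M π ℙ S A)
    {d : ℕ} (x : 𝒮 → EuclideanSpace ℝ (Fin d))
    (lam : ℝ) (hlam0 : 0 ≤ lam) (hlam1 : lam < 1) :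
    -- the average reward exists and the solution set is nonempty
    Tendsto (AvgTD.meanReward M ℙ S A) atTop (𝓝 (AvgTD.avgReward M ℙ S A)) ∧
    (AvgTD.Wstar M π x lam (AvgTD.avgReward M ℙ S A)).Nonempty ∧
    -- for sufficiently large `cβ` the augmented matrix is negative definite,
    -- and for each of its constants of negative definiteness `c`:
    ∃ cβ₀ : ℝ, 0 < cβ₀ ∧ ∀ cβ : ℝ, cβ₀ ≤ cβ →
      (∃ c : ℝ, 0 < c ∧ AvgTD.AugNegDef M π x lam cβ c) ∧
      ∀ c : ℝ, 0 < c → AvgTD.AugNegDef M π x lam cβ c →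
      ∀ ξ : ℝ, 1 / 2 < ξ → ξ ≤ 1 →
      -- for sufficiently large `α` and `t₀`, with `κ = α c`:
      ∃ α₀ T₀ : ℝ, 0 < α₀ ∧ 0 < T₀ ∧ ∀ α t₀ : ℝ, α₀ ≤ α → T₀ ≤ t₀ →
        1 < α * c ∧
        ∃ C : ℝ, 0 < C ∧
          ∀ (w₀ : EuclideanSpace ℝ (Fin d)) (J₀ : ℝ) (t : ℕ), 1 ≤ t →
            Integrable (fun ω =>
              AvgTD.sqError (AvgTD.avgReward M ℙ S A)
                (AvgTD.Wstar M π x lam (AvgTD.avgReward M ℙ S A))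
                (AvgTD.Jhat M.r (fun k => cβ * AvgTD.stepSize α t₀ ξ k) J₀
                  (fun k => S k ω) (fun k => A k ω) t)
                (AvgTD.weight M.r x lam (AvgTD.stepSize α t₀ ξ)
                  (fun k => cβ * AvgTD.stepSize α t₀ ξ k) w₀ J₀
                  (fun k => S k ω) (fun k => A k ω) t)) ℙ ∧
            ∫ ω,
              AvgTD.sqError (AvgTD.avgReward M ℙ S A)
                (AvgTD.Wstar M π x lam (AvgTD.avgReward M ℙ S A))
                (AvgTD.Jhat M.r (fun k => cβ * AvgTD.stepSize α t₀ ξ k) J₀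
                  (fun k => S k ω) (fun k => A k ω) t)
                (AvgTD.weight M.r x lam (AvgTD.stepSize α t₀ ξ)
                  (fun k => cβ * AvgTD.stepSize α t₀ ξ k) w₀ J₀
                  (fun k => S k ω) (fun k => A k ω) t) ∂ℙ
            ≤ C * (t₀ / (t : ℝ)) ^ ⌊α * c⌋₊ *
                AvgTD.sqError (AvgTD.avgReward M ℙ S A)
                  (AvgTD.Wstar M π x lam (AvgTD.avgReward M ℙ S A)) J₀ w₀
              + C * (Real.log ((t : ℝ) + t₀) /
                  ((t : ℝ) + t₀) ^ (min (2 * ξ - 1) ((⌊α * c⌋₊ : ℝ) - 1))) := by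
  have h0 := hlam0
  have h1 := hlam1
  have hJ := AvgTD.tendsto_meanReward hirr hSA
  have hJeq : AvgTD.avgReward M ℙ S A = AvgTD.statReward M π := hJ.limUnder_eq
  rw [hJeq]
  obtain ⟨w₁, hw₁⟩ := AvgTD.Wstar_nonempty (x := x) hirr h0 h1
  obtain ⟨cβ₀, hcβ₀, hneg⟩ := AvgTD.exists_augNegDef (x := x) hirr h0 h1
  refine ⟨hJ, ⟨w₁, hw₁⟩, cβ₀, hcβ₀, fun cβ hcβ => ⟨hneg cβ hcβ, fun c hc hcneg ξ hξ0 hξ1 => ?_⟩⟩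
  refine ⟨max 1 (3 / c), 2, by positivity, two_pos, fun α t₀ hα ht₀ => ?_⟩
  have hκ : 3 ≤ α * c := (div_le_iff₀ hc).1 ((le_max_right _ _).trans hα)
  refine ⟨by linarith, ?_⟩
  obtain ⟨C, hC, hb⟩ := AvgTD.exists_mean_sq_bound (S := S) (A := A) hirr hSA h0 h1 hc hcneg hw₁
    ((le_max_left _ _).trans hα) ht₀ hξ0 hξ1 hκ
  refine ⟨C, hC, fun w₀ J₀ t ht => ?_⟩
  simp only [AvgTD.sqError_eq_sqSize hirr h0 h1 hw₁]
  refine ⟨?_, hb w₀ J₀ t ht⟩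
  exact hSA.integrable (F := fun s a => AvgTD.sqSize (AvgTD.errorAt M π x lam cβ w₁
    (AvgTD.stepSize α t₀ ξ) w₀ J₀ s a t)) fun s s' a a' h h' =>
      congrArg AvgTD.sqSize (AvgTD.isHistory_errorAt cβ w₁ _ w₀ J₀ t s s' a a' h h')
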